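/- **Setting.** Let $G$ be a countable set of sites, $(S,\mathcal S)$ a measurable space with a finite measure $\lambda$, and let $\Omega=S^G$ carry the product $\sigma$-algebra. Let $\Phi=(\Phi_A)_{A\subset G,\ A\text{ finite}}$ be an absolutely summable potential: each $\Phi_A:\Omega\to\mathbb R$ is measurable with respect to the spins in $A$, and $\sum_{A\ni i}\|\Phi_A\|_\infty<\infty$ for every $i\in G$. For finite $\Lambda\subset G$ put $H_\Lambda=\sum_{A\cap\Lambda\ne\emptyset}\Phi_A$ and $$\gamma^\Phi_\Lambda(B\mid\eta)=\frac{\int 1_B(\omega_\Lambda\eta_{\Lambda^c})\,e^{-H_\Lambda(\omega_\Lambda\eta_{\Lambda^c})}\,\lambda^{\otimes\Lambda}(d\omega_\Lambda)}{\int e^{-H_\Lambda(\omega_\Lambda\eta_{\Lambda^c})}\,\lambda^{\otimes\Lambda}(d\omega_\Lambda)} .$$ Let $S=\bigcup_{k=1}^q S_k$ be a partition into measurable sets with $\lambda(S_k)>0$, let $T:S\to\{1,\dots,q\}$ be the map with $T(s)=k$ for $s\in S_k$, also applied sitewise to configurations, and let $\Omega'=\{1,\dots,q\}^G$. For $\omega'\in\Omega'$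 put $\Omega^{\omega'}=\{\omega\in\Omega: T(\omega)=\omega'\}$ and define the constrained specification $$\gamma^{\omega'}_\Lambda(B\mid\eta)=\frac{\gamma^\Phi_\Lambda\big(B\cap\{T(\omega_i)=\omega'_i\ \forall i\in\Lambda\}\mid\eta\big)}{\gamma^\Phi_\Lambda\big(T(\omega_i)=\omega'_i\ \forall i\in\Lambda\mid\eta\big)} .$$ A Gibbs measure for $\gamma^{\omega'}$ is a probability measure $\mu$ on $\Omega$ with $\mu(\Omega^{\omega'})=1$ and $\int\mu(d\eta)\,\gamma^{\omega'}_\Lambda(B\mid\eta)=\mu(B)$ for all finite $\Lambda\subset G$ and all measurable $B\subset\Omega$. Let $$\bar C_{ij}=\sup_{\omega'\in\Omega'}\ \sup_{\substack{\omega,\tilde\omega\in\Omega^{\omega'}\\ \omega_{j^c}=\tilde\omega_{j^c}}}\big\|\gamma^{\omega'}_{\{i\}}(\cdot|_i\mid\omega)-\gamma^{\omega'}_{\{i\}}(\cdot|_i\mid\tilde\omega)\big\|,\qquad \bar c=\sup_{i\in G}\sum_{j\in G}\bar C_{ij},$$ where $\cdot|_i$ denotes the marginal at the site $i$ and $\|\mu-\nu\|=\sup_B|\mu(B)-\nu(B)|$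 over measurable $B\subset S$. The tail $\sigma$-algebras are $\mathcal T=\bigcap_\Lambda\sigma(\omega_i:i\notin\Lambda)$ on $\Omega$ and $\mathcal T'=\bigcap_\Lambda\sigma(\omega'_i:i\notin\Lambda)$ on $\Omega'$, the intersections being over all finite $\Lambda\subset G$. A probability measure is trivial on a $\sigma$-algebra if it takes only the values $0$ and $1$ on it. **Proposition.** Assume the uniform Dobrushin condition $\bar c<1$. Then for every $\omega'\in\Omega'$ there is exactly one Gibbs measure $\mu_G[\omega']$ for $\gamma^{\omega'}$, and $\omega'\mapsto\mu_G[\omega']$ is a probability kernel from $\Omega'$ to $\Omega$. If $\mu'$ is any probability measure on $\Omega'$ (not necessarily Gibbs) that is trivial on $\mathcal T'$, then $$\mu(d\omega):=\int_{\Omega'}\mu'(d\omega')\,\mu_G[\omega'](d\omega)$$ is trivial on $\mathcal T$. -/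

import Mathlib

open MeasureTheory ProbabilityTheory
open scoped ENNReal

namespace ConstrainedGibbs

/-- A potential: for every finite set `A` of sites, a real function `Φ A` of the configuration which
is measurable with respect to the spins in `A`. -/
structure Potential (G S : Type*) [MeasurableSpace S] where
  toFun : Finset G → (G → S) → ℝ
  measurable_toFun : ∀ A : Finset G, Measurable[cylinderEvents (A : Set G)] (toFun A)

/-- Absolute summability: `∑_{A ∋ i} ‖Φ_A‖_∞ < ∞` for every site `i`. -/
def AbsolutelySummable {G S : Type*} [MeasurableSpace S] (Φ : Potential G S) : Prop :=
  ∀ i : G, ∑' A : {A : Finset G // i ∈ A}, ⨆ ω : G → S, ‖Φ.toFun A.1 ω‖ₑ < ∞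

/-- The Hamiltonian `H_Λ = ∑_{A ∩ Λ ≠ ∅} Φ_A` (an absolutely convergent series when `Φ` is
absolutely summable). -/
noncomputable def hamiltonian {G S : Type*} [MeasurableSpace S] (Φ : Potential G S)
    (Λ : Finset G) (ω : G → S) : ℝ :=
  ∑' A : {A : Finset G // ∃ i ∈ Λ, i ∈ A}, Φ.toFun A.1 ω

open Classical in
/-- The unnormalised Gibbs distribution in the finite volume `Λ` with boundary condition `η`:
the image of `exp (-H_Λ(ω_Λ η_{Λᶜ})) λ^{⊗Λ}(dω_Λ)` under `ω_Λ ↦ ω_Λ η_{Λᶜ}`. -/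
noncomputable def gibbsWeight {G S : Type*} [MeasurableSpace S] (Φ : Potential G S)
    (lam : Measure S) (Λ : Finset G) (η : G → S) : Measure (G → S) :=
  ((Measure.pi (fun _ : Λ => lam)).withDensity (fun σ =>
    ENNReal.ofReal (Real.exp (-hamiltonian Φ Λ (Function.updateFinset η Λ σ))))).map
      (fun σ => Function.updateFinset η Λ σ)

/-- The Gibbsian specification `γ^Φ_Λ(· | η)`. -/
noncomputable def gibbsSpec {G S : Type*} [MeasurableSpace S] (Φ : Potential G S)
    (lam : Measure S) (Λ : Finset G) (η : G → S) : Measure (G → S) :=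
  (gibbsWeight Φ lam Λ η Set.univ)⁻¹ • gibbsWeight Φ lam Λ η

/-- The constrained specification
`γ^{ω'}_Λ(B | η) = γ^Φ_Λ(B ∩ {T(ω_Λ) = ω'_Λ} | η) / γ^Φ_Λ(T(ω_Λ) = ω'_Λ | η)`. -/
noncomputable def constrainedSpec {G S : Type*} [MeasurableSpace S] (Φ : Potential G S)
    (lam : Measure S) {q : ℕ} (T : S → Fin q) (ω' : G → Fin q) (Λ : Finset G) (η : G → S) :
    Measure (G → S) :=
  ProbabilityTheory.cond (gibbsSpec Φ lam Λ η) {ω | ∀ i ∈ Λ, T (ω i) = ω' i}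

/-- `μ` is a Gibbs measure for the constrained specification `γ^{ω'}`: it is a probability measure
carried by `Ω^{ω'} = {ω | ∀ i, T (ω i) = ω' i}` satisfying the DLR equation in all finite volumes. -/
structure IsConstrainedGibbs {G S : Type*} [MeasurableSpace S] (Φ : Potential G S)
    (lam : Measure S) {q : ℕ} (T : S → Fin q) (ω' : G → Fin q) (μ : Measure (G → S)) : Prop where
  isProbabilityMeasure : IsProbabilityMeasure μ
  ae_mem : ∀ᵐ ω ∂μ, ∀ i, T (ω i) = ω' i
  dlr : ∀ (Λ : Finset G) (B : Set (G → S)), MeasurableSet B →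
    ∫⁻ η, constrainedSpec Φ lam T ω' Λ η B ∂μ = μ B

/-- The total variational distance `sup_B |μ(B) - ν(B)|` of two finite measures. -/
noncomputable def tvDistance {S : Type*} [MeasurableSpace S] (μ ν : Measure S) : ℝ≥0∞ :=
  ⨆ (B : Set S) (_ : MeasurableSet B), ENNReal.ofReal |μ.real B - ν.real B|

/-- The uniform Dobrushin matrix `C̄_{ij}`: the supremum over all `ω'` and all pairs `ω, ω̃` in
`Ω^{ω'}` that agree off `j` of the distance of the marginals at the site `i` of
`γ^{ω'}_{i}(· | ω)` and `γ^{ω'}_{i}(· | ω̃)`. -/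
noncomputable def dobrushinMatrix {G S : Type*} [MeasurableSpace S] (Φ : Potential G S)
    (lam : Measure S) {q : ℕ} (T : S → Fin q) (i j : G) : ℝ≥0∞ :=
  ⨆ (ω' : G → Fin q) (ω : G → S) (ω₂ : G → S) (_ : ∀ k, k ≠ j → ω k = ω₂ k)
    (_ : ∀ k, T (ω k) = ω' k) (_ : ∀ k, T (ω₂ k) = ω' k),
    tvDistance ((constrainedSpec Φ lam T ω' {i} ω).map (fun σ => σ i))
      ((constrainedSpec Φ lam T ω' {i} ω₂).map (fun σ => σ i))

/-- The uniform Dobrushin constant `c̄ = sup_i ∑_j C̄_{ij}`. -/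
noncomputable def dobrushinConstant {G S : Type*} [MeasurableSpace S] (Φ : Potential G S)
    (lam : Measure S) {q : ℕ} (T : S → Fin q) : ℝ≥0∞ :=
  ⨆ i : G, ∑' j : G, dobrushinMatrix Φ lam T i j

/-- The tail σ-algebra on `E^G`: the events that, for every finite `Λ`, depend measurably on the
spins outside `Λ` only. -/
@[reducible] def tailSigmaAlgebra (G E : Type*) [MeasurableSpace E] : MeasurableSpace (G → E) :=
  ⨅ Λ : Finset G, cylinderEvents ((Λ : Set G)ᶜ)

/-- Every tail event has measure `0` or `1`. -/
def TailTrivial {G E : Type*} [MeasurableSpace E] (μ : Measure (G → E)) : Prop :=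
  ∀ A : Set (G → E), MeasurableSet[tailSigmaAlgebra G E] A → μ A = 0 ∨ μ A = 1

end ConstrainedGibbs

/-! Fix a tail event `A` on `Ω`. Recolouring finitely many sites cannot destroy the fact that `A` is
charged. Given a Gibbs measure `μ` for `ω'` with `μ A ≠ 0`, restrict it to `A`, weight it by the
ratio of the new to the old partition function in a finite volume, and resample that volume with the
new colours `ω₂'`. After normalisation this is a Gibbs measure for `ω₂'` giving `A` mass one
(`exists_recolor`), and by uniqueness it is `muG ω₂'`. With no recolouring this is a zero-one law
for each `muG ω'`. With recolouring it shows that `{ω' | muG ω' A = 1}` ignores finite changes,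
hence is a tail event on `Ω'`. The mixture gives `A` exactly the `μ'`-mass of that set.

Uniqueness is Dobrushin's contraction. A function is controlled by a vector of weights bounding its
variation site by site; averaging over the spin at `i` transforms this vector by `dust`
(`HammingBound.average`), and suitable repeated averaging makes the total weight arbitrarily small
(`exists_dustList_tsum_lt`). Averages inside `Λ` are invisible to the specification in `Λ`, so
finite-volume expectations forget volume and boundary condition, uniformly over functions with given
weights (`exists_finset_lintegral_le`). Measurability of the kernel follows from the same limit.

Existence has to avoid topology on `S`: neither compactness nor Kolmogorov extension is available.
The uniformity above gives total variation limits of the finite-dimensional marginals. Bounded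
single-site densities make these limits successively absolutely continuous, so Radon-Nikodym kernels
and the Ionescu-Tulcea construction produce a measure (`exists_isProjectiveLimit`). The DLR equation
survives the limit because a finite-volume average is uniformly approximated, on configurations of
the right colours, by iterated single-site averages with summable weights. -/

namespace ConstrainedGibbs

/-! ### Contraction of oscillation vectors. -/

section Dust

variable {G : Type*}

open Classical in
/-- The update of a vector of oscillations under the averaging at the site `i`: the oscillation at
`i` is removed and spread over the other sites according to the matrix `C`. -/
noncomputable def dust (C : G → G → ℝ≥0∞) (i : G) (a : G → ℝ≥0∞) (j : G) : ℝ≥0∞ :=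
  if j = i then 0 else a j + C i j * a i

/-- Iterated update along a list of sites; the head of the list acts last. -/
noncomputable def dustList (C : G → G → ℝ≥0∞) (l : List G) (a : G → ℝ≥0∞) : G → ℝ≥0∞ :=
  l.foldr (dust C) a

lemma dustList_append (C : G → G → ℝ≥0∞) (l l' : List G) (a : G → ℝ≥0∞) :
    dustList C (l ++ l') a = dustList C l (dustList C l' a) := by
  simp [dustList]

variable {C : G → G → ℝ≥0∞} {c : ℝ≥0∞}

-- Redistributing mass that has already been moved does not increase it, since `c ≤ 1`; the original
-- mass of a site shrinks by the factor `c` when the site is first visited. The vector `b` collects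
-- the moved mass, the other term the original mass never visited.
open Classical in
lemma exists_dustList_le (hC : ∀ i, ∑' j, C i j ≤ c) (hc : c ≤ 1) (a : G → ℝ≥0∞) (l : List G) :
    ∃ b : G → ℝ≥0∞, (∑' j, b j ≤ c * ∑' j, if j ∈ l then a j else 0) ∧
      ∀ j, dustList C l a j ≤ b j + if j ∈ l then 0 else a j := by
  induction l with
  | nil => exact ⟨0, by simp, fun j => by simp [dustList]⟩
  | cons i l ih =>
    obtain ⟨b, hb, hle⟩ := ih
    -- The head acts last, so `r` is the original mass still sitting at `i`: all of it on a first
    -- visit, none afterwards.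
    set r : ℝ≥0∞ := if i ∈ l then 0 else a i with hr
    refine ⟨fun j => (if j = i then 0 else b j) + C i j * (b i + r), ?_, fun j => ?_⟩
    · have h1 : ∑' j, ((if j = i then 0 else b j) + C i j * (b i + r)) ≤
          (∑' j, b j) + c * r := by
        rw [ENNReal.tsum_add, ENNReal.tsum_mul_right]
        calc (∑' j, if j = i then 0 else b j) + (∑' j, C i j) * (b i + r)
            ≤ (∑' j, if j = i then 0 else b j) + c * (b i + r) := by gcongr; exact hC i
          _ ≤ (∑' j, if j = i then 0 else b j) + (b i + c * r) := by
              rw [mul_add]; gcongr; exact mul_le_of_le_one_left zero_le hc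
          _ = (∑' j, b j) + c * r := by
              rw [ENNReal.tsum_eq_add_tsum_ite (f := b) i]; ring
      refine h1.trans ?_
      calc (∑' j, b j) + c * r ≤ c * (∑' j, if j ∈ l then a j else 0) + c * r := by gcongr
        _ = c * ((∑' j, if j ∈ l then a j else 0) + ∑' j, if j = i then r else 0) := by
            rw [tsum_ite_eq, mul_add]
        _ ≤ c * ∑' j, if j ∈ i :: l then a j else 0 := by
            rw [← ENNReal.tsum_add]
            gcongr with j
            by_cases hj : j = i
            · subst hj; by_cases hl : j ∈ l <;> simp [hr, hl]
            · simp [hj]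
    · have : dustList C (i :: l) a j = dust C i (dustList C l a) j := rfl
      rw [this, dust]
      by_cases hj : j = i
      · simp [hj]
      · simp only [hj, if_false, List.mem_cons, false_or]
        calc dustList C l a j + C i j * dustList C l a i
            ≤ (b j + if j ∈ l then 0 else a j) + C i j * (b i + r) := by
              gcongr; exacts [hle j, hle i]
          _ = _ := by ring

open Classical in
lemma tsum_dustList_le (hC : ∀ i, ∑' j, C i j ≤ c) (hc : c ≤ 1) (a : G → ℝ≥0∞) (l : List G) :
    ∑' j, dustList C l a j ≤
      c * (∑' j, if j ∈ l then a j else 0) + ∑' j, if j ∈ l then 0 else a j := by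
  obtain ⟨b, hb, hle⟩ := exists_dustList_le hC hc a l
  calc ∑' j, dustList C l a j ≤ ∑' j, (b j + if j ∈ l then 0 else a j) :=
        ENNReal.tsum_le_tsum hle
    _ = (∑' j, b j) + ∑' j, if j ∈ l then 0 else a j := ENNReal.tsum_add
    _ ≤ _ := by gcongr

/-- Let `m` be the infimum of the total mass over all lists. Sweeping a finite set that carries all
but `δ` of the current mass multiplies the mass by `c`, up to `δ`; hence `m ≤ c * m` and `m = 0`. -/
lemma exists_dustList_tsum_lt (hC : ∀ i, ∑' j, C i j ≤ c) (hc : c < 1) {a : G → ℝ≥0∞}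
    (ha : ∑' j, a j ≠ ∞) {ε : ℝ≥0∞} (hε : 0 < ε) :
    ∃ l : List G, ∑' j, dustList C l a j < ε := by
  classical
  set m : ℝ≥0∞ := ⨅ l : List G, ∑' j, dustList C l a j with hm
  have hm_top : m ≠ ∞ := ne_top_of_le_ne_top ha (iInf_le_of_le [] le_rfl)
  have key (l : List G) (hl : ∑' j, dustList C l a j ≠ ∞) :
      m ≤ c * ∑' j, dustList C l a j := by
    refine ENNReal.le_of_forall_pos_le_add fun δ hδ _ => ?_
    set a' := dustList C l a
    have hev : ∀ᶠ s : Finset G in Filter.atTop, ∑' j : {j // j ∉ s}, a' j < δ :=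
      (ENNReal.tendsto_tsum_compl_atTop_zero hl).eventually_lt_const (by exact_mod_cast hδ)
    obtain ⟨s, hs⟩ := hev.exists
    have h1 := tsum_dustList_le hC hc.le a' s.toList
    rw [← dustList_append] at h1
    refine (iInf_le _ (s.toList ++ l)).trans (h1.trans ?_)
    gcongr
    · split_ifs <;> simp
    · refine le_trans (le_of_eq ?_) hs.le
      refine Eq.trans ?_ (tsum_subtype {j | j ∉ s} a').symm
      refine tsum_congr fun j => ?_
      by_cases hj : j ∈ s <;> simp [hj]
  have h0 : m = 0 := by
    by_contra hne
    have hlt : m < ∞ := hm_top.lt_top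
    have h2 : m ≤ c * m := by
      rw [hm, ENNReal.mul_iInf_of_ne (by simpa [hm] using fun h : c = 0 => hne (le_antisymm
        ((key [] ha).trans (by simp [h])) zero_le)) hc.ne_top]
      refine le_iInf fun l => ?_
      by_cases hl : ∑' j, dustList C l a j = ∞
      · by_cases hc0 : c = 0
        · exact absurd (le_antisymm ((key [] ha).trans (by simp [hc0])) zero_le) hne
        · simp [hl, hc0]
      · exact key l hl
    have h3 : c * m < 1 * m := ENNReal.mul_lt_mul_left hne hm_top hc
    rw [one_mul] at h3
    exact absurd h2 (not_le.2 h3)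
  have : m < ε := h0 ▸ hε
  exact iInf_lt_iff.1 this

-- When only sites of `Λ` may be visited, mass escaping from `Λ` is never recovered, but each full
-- sweep of `Λ` contracts the mass left inside by `c` without increasing the total. This version
-- serves the DLR equation in a fixed volume.
open Classical in
lemma exists_dustList_sum_lt (hC : ∀ i, ∑' j, C i j ≤ c) (hc : c < 1) {a : G → ℝ≥0∞}
    (ha : ∑' j, a j ≠ ∞) (Λ : Finset G) {ε : ℝ≥0∞} (hε : 0 < ε) :
    ∃ l : List G, (∀ i ∈ l, i ∈ Λ) ∧ (∑' j, dustList C l a j ≤ ∑' j, a j) ∧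
      (∑' j, if j ∈ Λ then dustList C l a j else 0) < ε := by
  have key (n : ℕ) : ∃ l : List G, (∀ i ∈ l, i ∈ Λ) ∧ (∑' j, dustList C l a j ≤ ∑' j, a j) ∧
      (∑' j, if j ∈ Λ then dustList C l a j else 0) ≤ c ^ n * ∑' j, a j := by
    induction n with
    | zero =>
      refine ⟨[], by simp, le_rfl, ?_⟩
      simp only [pow_zero, one_mul]
      exact ENNReal.tsum_le_tsum fun j => by split_ifs <;> simp [dustList]
    | succ n ih =>
      obtain ⟨l, hl, hle, hs⟩ := ih
      refine ⟨Λ.toList ++ l, by simpa [or_imp, forall_and] using hl, ?_, ?_⟩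
      · rw [dustList_append]
        refine (tsum_dustList_le hC hc.le _ _).trans (le_trans ?_ hle)
        calc _ ≤ (∑' j, if j ∈ Λ.toList then dustList C l a j else 0)
              + ∑' j, if j ∈ Λ.toList then 0 else dustList C l a j := by
              gcongr; exact mul_le_of_le_one_left zero_le hc.le
          _ = _ := by
              rw [← ENNReal.tsum_add]
              exact tsum_congr fun j => by split_ifs <;> simp
      · obtain ⟨b, hb, hble⟩ := exists_dustList_le hC hc.le (dustList C l a) Λ.toList
        rw [dustList_append]
        calc _ ≤ ∑' j, b j := ENNReal.tsum_le_tsum fun j => by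
              split_ifs with hj
              · simpa [hj] using hble j
              · simp
          _ ≤ _ := hb
          _ ≤ c * (c ^ n * ∑' j, a j) := by gcongr; simpa using hs
          _ = _ := by ring
  have ht : Filter.Tendsto (fun n : ℕ => c ^ n * ∑' j, a j) Filter.atTop (nhds 0) := by
    simpa using ENNReal.Tendsto.mul_const (ENNReal.tendsto_pow_atTop_nhds_zero_of_lt_one hc)
      (Or.inr ha)
  obtain ⟨n, hn⟩ := (ht.eventually_lt_const hε).exists
  obtain ⟨l, h1, h2, h3⟩ := key n
  exact ⟨l, h1, h2, h3.trans_lt hn⟩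

end Dust

/-! ### Integrals and limits in total variation. -/

section TotalVariation

variable {X : Type*} [MeasurableSpace X]

/-- Layer-cake formula: only levels between `0` and `a` contribute, and each costs at most `t`. -/
lemma lintegral_le_lintegral_add_of_le {μ ν : Measure X} {t : ℝ≥0∞}
    (h : ∀ B, MeasurableSet B → μ B ≤ ν B + t) {g : X → ℝ≥0∞} (hg : Measurable g) {a : ℝ≥0∞}
    (ha : a ≠ ∞) (hga : ∀ x, g x ≤ a) :
    ∫⁻ x, g x ∂μ ≤ ∫⁻ x, g x ∂ν + a * t := by
  have hlc (ρ : Measure X) : ∫⁻ x, g x ∂ρ =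
      ∫⁻ s in Set.Ioo 0 a.toReal, ρ {x | s < (g x).toReal} := by
    have h1 : ∫⁻ x, g x ∂ρ = ∫⁻ x, ENNReal.ofReal (g x).toReal ∂ρ :=
      lintegral_congr fun x => (ENNReal.ofReal_toReal (ne_top_of_le_ne_top ha (hga x))).symm
    rw [h1, lintegral_eq_lintegral_meas_lt ρ (Filter.Eventually.of_forall fun x => by positivity)
      hg.ennreal_toReal.aemeasurable, ← lintegral_indicator measurableSet_Ioi,
      ← lintegral_indicator measurableSet_Ioo]
    refine lintegral_congr fun s => ?_
    by_cases hs : 0 < s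
    · by_cases hsa : s < a.toReal
      · simp [hs, hsa]
      · have : {x | s < (g x).toReal} = ∅ := by
          ext x
          simpa using (ENNReal.toReal_mono ha (hga x)).trans (not_lt.1 hsa)
        simp [this, hs, hsa]
    · simp [hs]
  rw [hlc μ, hlc ν]
  calc ∫⁻ s in Set.Ioo 0 a.toReal, μ {x | s < (g x).toReal}
      ≤ ∫⁻ s in Set.Ioo 0 a.toReal, (ν {x | s < (g x).toReal} + t) :=
        lintegral_mono fun s => h _ (measurableSet_lt measurable_const hg.ennreal_toReal)
    _ = _ := by
        rw [lintegral_add_right _ measurable_const]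
        simp [ENNReal.ofReal_toReal ha, mul_comm]

/-- If the oscillation of `g` on a set carrying `μ` and `ν` is at most `a`, then the integrals of
`g` differ by at most `a` times the variation distance. -/
lemma lintegral_le_lintegral_add_osc {μ ν : Measure X} [IsProbabilityMeasure μ]
    [IsProbabilityMeasure ν] {t : ℝ≥0∞}
    (h : ∀ B, MeasurableSet B → μ B ≤ ν B + t) {g : X → ℝ≥0∞} (hg : Measurable g)
    (hg1 : ∀ x, g x ≤ 1) {E : Set X} (hE : MeasurableSet E) (hμ : ∀ᵐ x ∂μ, x ∈ E)
    (hν : ∀ᵐ x ∂ν, x ∈ E) {a : ℝ≥0∞} (hga : ∀ x ∈ E, ∀ y ∈ E, g x ≤ g y + a) :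
    ∫⁻ x, g x ∂μ ≤ ∫⁻ x, g x ∂ν + a * t := by
  obtain ⟨x₀, hx₀⟩ : E.Nonempty := by
    obtain ⟨x, hx⟩ := hμ.exists
    exact ⟨x, hx⟩
  set m : ℝ≥0∞ := ⨅ x : E, g x with hm
  have hmle : ∀ x ∈ E, m ≤ g x := fun x hx => iInf_le_of_le ⟨x, hx⟩ le_rfl
  have hm1 : m ≠ ∞ := ne_top_of_le_ne_top ENNReal.one_ne_top ((hmle _ hx₀).trans (hg1 _))
  -- The bound `a` may be infinite; capping it at `1` is harmless because `g ≤ 1`.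
  have hgm : ∀ x ∈ E, g x ≤ m + min a 1 := by
    intro x hx
    have : Nonempty E := ⟨⟨x₀, hx₀⟩⟩
    rw [hm, ENNReal.iInf_add]
    refine le_iInf fun y => ?_
    rcases le_total a 1 with h1 | h1
    · rw [min_eq_left h1]; exact hga x hx y y.2
    · rw [min_eq_right h1]; exact (hg1 x).trans le_add_self
  set g' : X → ℝ≥0∞ := E.indicator fun x => g x - m with hg'
  have hg'm : Measurable g' := (hg.sub measurable_const).indicator hE
  have heq (ρ : Measure X) [IsProbabilityMeasure ρ] (hρ : ∀ᵐ x ∂ρ, x ∈ E) :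
      ∫⁻ x, g x ∂ρ = ∫⁻ x, g' x ∂ρ + m := by
    have : ∫⁻ x, g x ∂ρ = ∫⁻ x, (g' x + m) ∂ρ := by
      refine lintegral_congr_ae ?_
      filter_upwards [hρ] with x hx
      simp [hg', hx, tsub_add_cancel_of_le (hmle x hx)]
    rw [this, lintegral_add_right _ measurable_const]
    simp
  have key := lintegral_le_lintegral_add_of_le h hg'm (a := min a 1)
    (ne_top_of_le_ne_top ENNReal.one_ne_top (min_le_right _ _)) (fun x => by
      by_cases hx : x ∈ E
      · simp only [hg', hx, Set.indicator_of_mem]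
        exact tsub_le_iff_left.2 (hgm x hx)
      · simp [hg', hx])
  rw [heq μ hμ, heq ν hν]
  calc ∫⁻ x, g' x ∂μ + m ≤ (∫⁻ x, g' x ∂ν + min a 1 * t) + m := by gcongr
    _ ≤ (∫⁻ x, g' x ∂ν + a * t) + m := by gcongr; exact min_le_left _ _
    _ = _ := by ring

/-- A net of probability measures which is Cauchy in total variation converges in total variation
to a probability measure. -/
lemma exists_tv_limit {ι : Type*} {l : Filter ι} [l.NeBot] {ν : ι → Measure X}
    (hν : ∀ i, IsProbabilityMeasure (ν i))
    (hc : ∀ ε : ℝ≥0∞, 0 < ε → ∀ᶠ i in l, ∀ᶠ j in l, ∀ B, MeasurableSet B →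
      ν i B ≤ ν j B + ε ∧ ν j B ≤ ν i B + ε) :
    ∃ P : Measure X, IsProbabilityMeasure P ∧ ∀ ε : ℝ≥0∞, 0 < ε → ∀ᶠ i in l,
      ∀ B, MeasurableSet B → ν i B ≤ P B + ε ∧ P B ≤ ν i B + ε := by
  classical
  -- The limsup only names the limit, which exists on measurable sets by the Cauchy property.
  set p : Set X → ℝ≥0∞ := fun B => l.limsup fun j => ν j B with hp
  have hbd (ε : ℝ≥0∞) (hε : 0 < ε) : ∀ᶠ i in l, ∀ B, MeasurableSet B →
      ν i B ≤ p B + ε ∧ p B ≤ ν i B + ε := by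
    filter_upwards [hc ε hε] with i hi B hB
    constructor
    · rw [← tsub_le_iff_right]
      refine Filter.le_limsup_of_frequently_le ?_
      exact (hi.mono fun j hj => tsub_le_iff_right.2 (hj B hB).1).frequently
    · refine Filter.limsup_le_of_le (by isBoundedDefault) ?_
      exact hi.mono fun j hj => (hj B hB).2
  have htend (B : Set X) (hB : MeasurableSet B) : Filter.Tendsto (fun i => ν i B) l (nhds (p B)) := by
    rw [ENNReal.tendsto_nhds]
    · intro ε hε
      filter_upwards [hbd ε hε] with i hi
      exact ⟨tsub_le_iff_right.2 (hi B hB).2, (hi B hB).1⟩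
    · obtain ⟨i, hi⟩ := (hbd 1 one_pos).exists
      exact ne_top_of_le_ne_top (by simp) (hi B hB).2
  have hadd (A B : Set X) (hA : MeasurableSet A) (hB : MeasurableSet B) (hAB : Disjoint A B) :
      p (A ∪ B) = p A + p B := by
    refine tendsto_nhds_unique (htend _ (hA.union hB)) ?_
    simpa only [measure_union hAB hB] using (htend A hA).add (htend B hB)
  have hmono (A B : Set X) (hA : MeasurableSet A) (hB : MeasurableSet B) (hAB : A ⊆ B) :
      p A ≤ p B :=
    le_of_tendsto_of_tendsto' (htend A hA) (htend B hB) fun i => measure_mono hAB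
  have hempty : p ∅ = 0 := tendsto_nhds_unique (htend ∅ .empty) (by simp)
  have hfin (f : ℕ → Set X) (hf : ∀ n, MeasurableSet (f n)) (hd : Pairwise (Function.onFun Disjoint f))
      (n : ℕ) : p (⋃ k ∈ Finset.range n, f k) = ∑ k ∈ Finset.range n, p (f k) := by
    induction n with
    | zero => simpa using hempty
    | succ n ih =>
      rw [Finset.range_add_one, Finset.set_biUnion_insert, Finset.sum_insert (by simp), ← ih]
      refine hadd _ _ (hf n) (Finset.measurableSet_biUnion _ fun k _ => hf k) ?_
      rw [Set.disjoint_iUnion₂_right]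
      exact fun k hk => hd (by simp at hk; omega)
  have hsum (f : ℕ → Set X) (hf : ∀ n, MeasurableSet (f n))
      (hd : Pairwise (Function.onFun Disjoint f)) : p (⋃ n, f n) = ∑' n, p (f n) := by
    have hU := MeasurableSet.iUnion hf
    refine le_antisymm ?_ ?_
    · refine ENNReal.le_of_forall_pos_le_add fun ε hε _ => ?_
      -- A single `ν i` is close to `p` on all measurable sets at once, so countable additivity of
      -- that `ν i` controls the remainder of the union.
      obtain ⟨i, hi⟩ := (hbd (ε / 2) (by simpa using hε.ne')).exists
      have hsumi : ν i (⋃ n, f n) = ∑' n, ν i (f n) := measure_iUnion hd hf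
      have htail : Filter.Tendsto (fun n => ν i ((⋃ n, f n) \ ⋃ k ∈ Finset.range n, f k))
          Filter.atTop (nhds 0) := by
        have h0 : ⋂ n, ((⋃ n, f n) \ ⋃ k ∈ Finset.range n, f k) = ∅ := by
          ext x
          simp only [Set.mem_iInter, Set.mem_sdiff, Set.mem_iUnion, Finset.mem_range,
            Set.mem_empty_iff_false, iff_false, not_forall]
          by_cases hx : ∃ n, x ∈ f n
          · obtain ⟨n, hn⟩ := hx
            exact ⟨n + 1, fun h => h.2 ⟨n, by omega, hn⟩⟩
          · exact ⟨0, fun h => hx h.1⟩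
        rw [← measure_empty (μ := ν i), ← h0]
        refine tendsto_measure_iInter_atTop
          (fun n => (hU.diff (Finset.measurableSet_biUnion _ fun k _ => hf k)).nullMeasurableSet)
          (fun m n hmn => ?_) ⟨0, measure_ne_top _ _⟩
        exact Set.sdiff_subset_sdiff_right (Set.biUnion_subset_biUnion_left
          (by simpa using hmn))
      obtain ⟨n, hn⟩ := (htail.eventually_le_const
        (show (0 : ℝ≥0∞) < ε / 2 by simpa using hε.ne')).exists
      have hVm : MeasurableSet (⋃ k ∈ Finset.range n, f k) :=
        Finset.measurableSet_biUnion _ fun k _ => hf k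
      have hdec : p (⋃ n, f n) = p (⋃ k ∈ Finset.range n, f k) +
          p ((⋃ n, f n) \ ⋃ k ∈ Finset.range n, f k) := by
        rw [← hadd _ _ hVm (hU.diff hVm) Set.disjoint_sdiff_right,
          Set.union_sdiff_cancel (Set.iUnion₂_subset fun k _ => Set.subset_iUnion f k)]
      rw [hdec, hfin f hf hd]
      calc (∑ k ∈ Finset.range n, p (f k)) + p ((⋃ n, f n) \ ⋃ k ∈ Finset.range n, f k)
          ≤ (∑' n, p (f n)) + (ε / 2 + ε / 2) := by
            gcongr
            · exact ENNReal.sum_le_tsum _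
            · exact (hi _ (hU.diff hVm)).2.trans (by gcongr)
        _ = _ := by rw [ENNReal.add_halves]
    · rw [ENNReal.tsum_eq_iSup_nat]
      refine iSup_le fun n => ?_
      rw [← hfin f hf hd]
      exact hmono _ _ (Finset.measurableSet_biUnion _ fun k _ => hf k) hU
        (Set.iUnion₂_subset fun k _ => Set.subset_iUnion f k)
  set P : Measure X := Measure.ofMeasurable (fun B _ => p B) hempty (fun f hf hd => hsum f hf hd)
  have hP (B : Set X) (hB : MeasurableSet B) : P B = p B := Measure.ofMeasurable_apply B hB
  refine ⟨P, ⟨?_⟩, fun ε hε => ?_⟩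
  · rw [hP _ .univ]
    exact tendsto_nhds_unique (htend _ .univ) (by simp)
  · filter_upwards [hbd ε hε] with i hi B hB
    rw [hP B hB]
    exact hi B hB

end TotalVariation

/-! ### Extension without regularity of the spin space. -/

section Extension

/-- A probability measure on a product space which is absolutely continuous with respect to the
product of its first marginal and a finite measure disintegrates over its first marginal. No
regularity of the spaces is needed. -/
lemma exists_compProd_eq_of_absolutelyContinuous {X Y : Type*} [MeasurableSpace X]
    [MeasurableSpace Y] (μ : Measure X) [IsProbabilityMeasure μ] (β : Measure Y) [IsFiniteMeasure β]
    (ρ : Measure (X × Y)) [IsProbabilityMeasure ρ] (hfst : ρ.fst = μ) (hρ : ρ ≪ μ.prod β) :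
    ∃ κ : Kernel X Y, IsMarkovKernel κ ∧ μ ⊗ₘ κ = ρ := by
  classical
  set f : X × Y → ℝ≥0∞ := ρ.rnDeriv (μ.prod β) with hf
  have hfm : Measurable f := Measure.measurable_rnDeriv _ _
  have hρf : ρ = (μ.prod β).withDensity f := (Measure.withDensity_rnDeriv_eq _ _ hρ).symm
  set g : X → ℝ≥0∞ := fun x => ∫⁻ y, f (x, y) ∂β
  have hgm : Measurable g := hfm.lintegral_prod_right'
  have hrect (A : Set X) (hA : MeasurableSet A) (B : Set Y) (hB : MeasurableSet B) :
      ρ (A ×ˢ B) = ∫⁻ x in A, ∫⁻ y in B, f (x, y) ∂β ∂μ := by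
    rw [hρf, withDensity_apply _ (hA.prod hB), ← Measure.prod_restrict,
      lintegral_prod _ hfm.aemeasurable]
  have hg1 : g =ᵐ[μ] fun _ => 1 := by
    refine ae_eq_of_forall_setLIntegral_eq_of_sigmaFinite hgm measurable_const fun A hA _ => ?_
    have := hrect A hA .univ .univ
    rw [Set.prod_univ] at this
    rw [← Measure.fst_apply hA, hfst] at this
    simpa [g] using this.symm
  obtain ⟨z⟩ : Nonempty (X × Y) := nonempty_of_isProbabilityMeasure ρ
  set E : Set X := g ⁻¹' {1} with hE
  have hEm : MeasurableSet E := hgm (measurableSet_singleton 1)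
  set κ₁ : Kernel X Y := Kernel.withDensity (Kernel.const X β) fun x y => f (x, y)
  have hκ₁ (x : X) : κ₁ x = β.withDensity fun y => f (x, y) := by
    simp only [κ₁]
    rw [Kernel.withDensity_apply _ (by exact hfm)]
    simp
  -- Off `E`, a null set by `hg1`, the fibre density need not have mass one; a Dirac mass there
  -- makes the kernel Markov everywhere.
  set κ : Kernel X Y := Kernel.piecewise hEm κ₁ (Kernel.const X (Measure.dirac z.2))
  have hκM : IsMarkovKernel κ := by
    refine ⟨fun x => ⟨?_⟩⟩
    by_cases hx : x ∈ E
    · simp only [κ, Kernel.piecewise_apply, hx, if_true, hκ₁]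
      rw [withDensity_apply _ .univ, Measure.restrict_univ]
      exact hx
    · simp [κ, Kernel.piecewise_apply, hx]
  refine ⟨κ, hκM, ?_⟩
  refine Measure.ext_prod fun {A B} hA hB => ?_
  rw [hrect A hA B hB, Measure.compProd_apply_prod hA hB]
  refine lintegral_congr_ae (ae_restrict_of_ae ?_)
  filter_upwards [hg1] with x hx
  have hxE : x ∈ E := hx
  simp only [κ, Kernel.piecewise_apply, hxE, if_true, hκ₁]
  exact withDensity_apply _ hB

open Preorder Finset in
/-- A consistent sequence of finite-dimensional distributions which are successively absolutely
continuous with respect to product measures comes from a measure on the sequence space. -/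
lemma exists_measure_nat {S : Type*} [MeasurableSpace S] (P : ∀ n : ℕ, Measure (Iic n → S))
    (hP : ∀ n, IsProbabilityMeasure (P n)) (β : ℕ → Measure S) (hβ : ∀ n, IsFiniteMeasure (β n))
    (hproj : ∀ n, (P (n + 1)).map (frestrictLe₂ (π := fun _ => S) n.le_succ) = P n)
    (habs : ∀ n, (P (n + 1)).map (fun x => (frestrictLe₂ (π := fun _ => S) n.le_succ x,
      x ⟨n + 1, by simp⟩)) ≪ (P n).prod (β n)) :
    ∃ μ : Measure (ℕ → S), IsProbabilityMeasure μ ∧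
      ∀ n, μ.map (frestrictLe (π := fun _ => S) n) = P n := by
  have hmeas (n : ℕ) : Measurable (fun x : Iic (n + 1) → S =>
      (frestrictLe₂ (π := fun _ => S) n.le_succ x, x (⟨n + 1, by simp⟩ : Iic (n + 1)))) :=
    (measurable_frestrictLe₂ (X := fun _ => S) n.le_succ).prodMk
      (measurable_pi_apply (X := fun _ => S) _)
  have hex (n : ℕ) : ∃ κ : Kernel (Iic n → S) S, IsMarkovKernel κ ∧
      P n ⊗ₘ κ = (P (n + 1)).map (fun x => (frestrictLe₂ (π := fun _ => S) n.le_succ x,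
        x ⟨n + 1, by simp⟩)) := by
    have := Measure.isProbabilityMeasure_map (μ := P (n + 1)) (hmeas n).aemeasurable
    refine exists_compProd_eq_of_absolutelyContinuous (P n) (β n) _ ?_ (habs n)
    rw [Measure.fst, Measure.map_map measurable_fst (hmeas n)]
    exact hproj n
  choose κ hκM hκ using hex
  set μ₀ : Measure S := (P 0).map (fun x => x ⟨0, by simp⟩)
  have : IsProbabilityMeasure μ₀ :=
    Measure.isProbabilityMeasure_map (measurable_pi_apply _).aemeasurable
  refine ⟨Kernel.trajMeasure (X := fun _ => S) μ₀ κ, inferInstance, fun n => ?_⟩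
  induction n with
  | zero =>
    rw [Kernel.trajMeasure, Measure.map_comp _ _ (by fun_prop), Kernel.traj_map_frestrictLe,
      Kernel.partialTraj_self, Measure.id_comp, Measure.map_map (by fun_prop) (by fun_prop)]
    convert Measure.map_id
    ext x i
    obtain ⟨i, hi⟩ := i
    obtain rfl : i = 0 := by simpa using hi
    rfl
  | succ n ih =>
    have h := Kernel.map_frestrictLe_trajMeasure_compProd_eq_map_trajMeasure
      (X := fun _ => S) (μ₀ := μ₀) (κ := κ) (a := n)
    rw [ih, hκ n] at h
    -- Glues the last coordinate back on, turning the identity for pairs into one for the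
    -- coordinates up to `n + 1`.
    set e : (Iic n → S) × S → (Iic (n + 1) → S) := fun z i =>
      if hi : i.1 ≤ n then z.1 ⟨i.1, by simpa using hi⟩ else z.2 with he
    have hem : Measurable e := by
      refine measurable_pi_iff.2 fun i => ?_
      by_cases hi : i.1 ≤ n
      · simp only [he, hi, dif_pos]; fun_prop
      · simp only [he, hi, dif_neg, not_false_iff]; fun_prop
    have h2 := congrArg (Measure.map e) h
    rw [Measure.map_map hem (hmeas n), Measure.map_map hem (by fun_prop)] at h2
    have e1 : (e ∘ fun x : Iic (n + 1) → S => (frestrictLe₂ (π := fun _ => S) n.le_succ x,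
        x (⟨n + 1, by simp⟩ : Iic (n + 1)))) = id := by
      ext x i
      by_cases hi : i.1 ≤ n
      · simp [he, hi]
      · have : i = ⟨n + 1, by simp⟩ := by
          ext; have := Finset.mem_Iic.1 i.2; simp only; omega
        subst this
        simp [he]
    have e2 : (e ∘ fun x : ℕ → S => (frestrictLe (π := fun _ => S) n x, x (n + 1))) =
        frestrictLe (π := fun _ => S) (n + 1) := by
      ext x i
      by_cases hi : i.1 ≤ n
      · simp [he, hi]
      · have : i.1 = n + 1 := by have := Finset.mem_Iic.1 i.2; omega
        simp [he, this]
    rw [e1, e2, Measure.map_id] at h2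
    exact h2.symm

end Extension

/-! ### Projective limits over a countable set of sites. -/

section ProjectiveLimit

/-- An extension theorem on arbitrary measurable spaces: a projective family of probability measures
over a countable set of sites has a projective limit if adding a site always yields a measure
that is absolutely continuous with respect to a product measure. -/
lemma exists_isProjectiveLimit {G S : Type*} [Countable G] [MeasurableSpace S]
    (P : ∀ D : Finset G, Measure (D → S)) (hP : ∀ D, IsProbabilityMeasure (P D))
    (hproj : IsProjectiveMeasureFamily (α := fun _ => S) P) (β : G → Measure S) (hβ : ∀ i, IsFiniteMeasure (β i))
    (habs : ∀ (D D' : Finset G) (h : D ⊆ D') (i : G) (hi : i ∈ D'), i ∉ D →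
      (P D').map (fun x => (Finset.restrict₂ (π := fun _ => S) h x, x ⟨i, hi⟩)) ≪
        (P D).prod (β i)) :
    ∃ μ : Measure (G → S), IsProbabilityMeasure μ ∧ IsProjectiveLimit (α := fun _ => S) μ P := by
  classical
  rcases finite_or_infinite G with hG | hG
  · have := Fintype.ofFinite G
    have hm : Measurable (fun (x : {g // g ∈ (Finset.univ : Finset G)} → S) (g : G) => x ⟨g, by simp⟩) :=
      measurable_pi_iff.2 fun g => measurable_pi_apply (X := fun _ => S) _
    refine ⟨(P Finset.univ).map fun x g => x ⟨g, by simp⟩,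
      Measure.isProbabilityMeasure_map hm.aemeasurable, fun I => ?_⟩
    rw [Measure.map_map (Finset.measurable_restrict (X := fun _ => S) _) hm, hproj _ I (Finset.subset_univ I)]
    rfl
  · obtain ⟨_⟩ := nonempty_denumerable G
    set e : ℕ ≃ G := (Denumerable.eqv G).symm
    set D : ℕ → Finset G := fun n => (Finset.Iic n).map e.toEmbedding with hD
    have hmem {n : ℕ} (i : Finset.Iic n) : e i ∈ D n := by
      simp [hD]
    have hsub {m n : ℕ} (h : m ≤ n) : D m ⊆ D n :=
      Finset.map_subset_map.2 (Finset.Iic_subset_Iic.2 h)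
    set φ : ∀ n, (D n → S) → (Finset.Iic n → S) := fun n x i => x ⟨e i, hmem i⟩ with hφ
    have hφm (n : ℕ) : Measurable (φ n) := measurable_pi_iff.2 fun i => measurable_pi_apply (X := fun _ => S) _
    obtain ⟨μ, hμ, hμP⟩ := exists_measure_nat (fun n => (P (D n)).map (φ n))
      (fun n => Measure.isProbabilityMeasure_map (hφm n).aemeasurable) (fun n => β (e (n + 1)))
      (fun n => hβ _) (fun n => by
        rw [Measure.map_map (Preorder.measurable_frestrictLe₂ (X := fun _ => S) _) (hφm _),
          hproj (D (n + 1)) (D n) (hsub n.le_succ), Measure.map_map (hφm _)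
            (Finset.measurable_restrict₂ (X := fun _ => S) _)]
        rfl) (fun n => by
        have h0 := habs (D n) (D (n + 1)) (hsub n.le_succ) (e (n + 1))
          (hmem (⟨n + 1, by simp⟩ : Finset.Iic (n + 1))) (by simp [hD])
        have h1 := h0.map (f := Prod.map (φ n) id) ((hφm n).prodMap measurable_id)
        rw [← Measure.map_prod_map _ _ (hφm n) measurable_id, Measure.map_id,
          Measure.map_map ((hφm n).prodMap measurable_id)
            ((Finset.measurable_restrict₂ (X := fun _ => S) _).prodMk (measurable_pi_apply (X := fun _ => S) _))] at h1
        rw [Measure.map_map ((Preorder.measurable_frestrictLe₂ (X := fun _ => S) _).prodMk (measurable_pi_apply (X := fun _ => S) _))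
          (hφm _)]
        exact h1)
    have hm : Measurable (fun (y : ℕ → S) (g : G) => y (e.symm g)) :=
      measurable_pi_iff.2 fun g => measurable_pi_apply (X := fun _ => S) _
    refine ⟨μ.map fun y g => y (e.symm g), Measure.isProbabilityMeasure_map hm.aemeasurable,
      fun I => ?_⟩
    set n := (I.image e.symm).sup id with hn
    have hle (g : I) : e.symm g ≤ n :=
      Finset.le_sup (f := id) (Finset.mem_image_of_mem e.symm g.2)
    have hI : I ⊆ D n := fun g hg => by
      simp only [hD, Finset.mem_map, Finset.mem_Iic]
      exact ⟨e.symm g, hle ⟨g, hg⟩, by simp⟩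
    set ψ : (Finset.Iic n → S) → (I → S) := fun x g => x ⟨e.symm g, by simpa using hle g⟩
    have hψ : Measurable ψ := measurable_pi_iff.2 fun i => measurable_pi_apply (X := fun _ => S) _
    have h1 := congrArg (Measure.map ψ) (hμP n)
    rw [Measure.map_map hψ (Preorder.measurable_frestrictLe (X := fun _ => S) _), Measure.map_map hψ (hφm n)] at h1
    have h2 : ψ ∘ φ n = Finset.restrict₂ (π := fun _ => S) hI := by
      ext x g
      simp [ψ, hφ]
    rw [h2, ← hproj (D n) I hI] at h1
    rw [← h1, Measure.map_map (Finset.measurable_restrict (X := fun _ => S) _) hm]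
    rfl

end ProjectiveLimit

/-! ### Hamiltonians and Boltzmann factors. -/

section Hamiltonian

/-- The level set of `f` through `x` is a preimage under restriction to `Δ`, so it contains every
`y` agreeing with `x` there. -/
lemma dependsOn_of_measurable_cylinderEvents {G E Y : Type*} [MeasurableSpace E]
    [MeasurableSpace Y] [MeasurableSingletonClass Y] {Δ : Set G} {f : (G → E) → Y}
    (hf : Measurable[cylinderEvents Δ] f) : DependsOn f Δ := by
  intro x y hxy
  have hle : cylinderEvents (X := fun _ : G => E) Δ ≤
      MeasurableSpace.comap (fun (σ : G → E) (i : Δ) => σ i) MeasurableSpace.pi := by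
    refine iSup₂_le fun i hi => ?_
    have : (fun σ : G → E => σ i) =
        (fun τ : Δ → E => τ ⟨i, hi⟩) ∘ fun (σ : G → E) (i : Δ) => σ i := rfl
    rw [this, ← MeasurableSpace.comap_comp]
    exact MeasurableSpace.comap_mono (measurable_pi_apply (X := fun _ : Δ => E) _).comap_le
  obtain ⟨A, -, hA⟩ := hle _ (hf (measurableSet_singleton (f x)))
  have hx : x ∈ f ⁻¹' {f x} := rfl
  rw [← hA] at hx
  have hy : y ∈ f ⁻¹' {f x} := by
    rw [← hA]
    have : (fun i : Δ => y i) = fun i : Δ => x i := funext fun i => (hxy i i.2).symm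
    simpa [this] using hx
  exact hy.symm

lemma mem_iff_of_measurableSet_cylinderEvents {G E : Type*} [MeasurableSpace E] {Δ : Set G}
    {A : Set (G → E)} (hA : MeasurableSet[cylinderEvents Δ] A) {x y : G → E}
    (hxy : ∀ i ∈ Δ, x i = y i) : x ∈ A ↔ y ∈ A := by
  have h : DependsOn (fun z => z ∈ A) Δ :=
    dependsOn_of_measurable_cylinderEvents (@MeasurableSet.mem _ A (cylinderEvents Δ) hA)
  exact iff_of_eq (h hxy)

variable {G S : Type*} [MeasurableSpace S] (Φ : Potential G S)

/-- The supremum norm of an interaction term. -/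
noncomputable def Potential.supNorm (A : Finset G) : ℝ≥0∞ := ⨆ ω : G → S, ‖Φ.toFun A ω‖ₑ

/-- A bound for the Hamiltonian in the volume `Λ`. -/
noncomputable def energyBound (Λ : Finset G) : ℝ :=
  ∑' A : {A : Finset G // ∃ i ∈ Λ, i ∈ A}, (Φ.supNorm A.1).toReal

variable {Φ} (hΦ : AbsolutelySummable Φ)

include hΦ in
lemma tsum_supNorm_ne_top (Λ : Finset G) :
    ∑' A : {A : Finset G // ∃ i ∈ Λ, i ∈ A}, Φ.supNorm A.1 ≠ ∞ := by
  classical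
  have hle : ∑' A : {A : Finset G // ∃ i ∈ Λ, i ∈ A}, Φ.supNorm A.1 ≤
      ∑ i ∈ Λ, ∑' A : {A : Finset G // i ∈ A}, Φ.supNorm A.1 := by
    have h1 (i : G) : ∑' A : {A : Finset G // i ∈ A}, Φ.supNorm A.1 =
        ∑' A, Set.indicator {A : Finset G | i ∈ A} Φ.supNorm A :=
      tsum_subtype {A : Finset G | i ∈ A} Φ.supNorm
    simp_rw [h1]
    rw [← Summable.tsum_finsetSum fun i _ => ENNReal.summable]
    refine (tsum_subtype {A : Finset G | ∃ i ∈ Λ, i ∈ A} Φ.supNorm).le.trans ?_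
    refine ENNReal.tsum_le_tsum fun A => ?_
    by_cases hA : ∃ i ∈ Λ, i ∈ A
    · obtain ⟨i, hi, hiA⟩ := hA
      rw [Set.indicator_of_mem (show A ∈ {A : Finset G | ∃ i ∈ Λ, i ∈ A} from ⟨i, hi, hiA⟩)]
      refine le_trans (le_of_eq ?_) (Finset.single_le_sum (fun _ _ => zero_le) hi)
      rw [Set.indicator_of_mem (show A ∈ {A : Finset G | i ∈ A} from hiA)]
    · rw [Set.indicator_of_notMem (by exact hA)]
      exact zero_le
  refine ne_top_of_le_ne_top ?_ hle
  exact ENNReal.sum_ne_top.2 fun i _ => (hΦ i).ne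

include hΦ in
lemma summable_supNorm (Λ : Finset G) :
    Summable fun A : {A : Finset G // ∃ i ∈ Λ, i ∈ A} => (Φ.supNorm A.1).toReal :=
  ENNReal.summable_toReal (tsum_supNorm_ne_top hΦ Λ)

include hΦ in
lemma norm_toFun_le {Λ : Finset G} (A : {A : Finset G // ∃ i ∈ Λ, i ∈ A}) (ω : G → S) :
    ‖Φ.toFun A.1 ω‖ ≤ (Φ.supNorm A.1).toReal := by
  have h1 : ‖Φ.toFun A.1 ω‖ₑ ≤ Φ.supNorm A.1 := le_iSup (fun ω => ‖Φ.toFun A.1 ω‖ₑ) ω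
  have := ENNReal.toReal_mono (ENNReal.ne_top_of_tsum_ne_top (tsum_supNorm_ne_top hΦ Λ) A) h1
  simpa using this

include hΦ in
lemma summable_toFun (Λ : Finset G) (ω : G → S) :
    Summable fun A : {A : Finset G // ∃ i ∈ Λ, i ∈ A} => Φ.toFun A.1 ω :=
  Summable.of_norm_bounded (summable_supNorm hΦ Λ) fun A => norm_toFun_le hΦ A ω

include hΦ in
lemma abs_hamiltonian_le (Λ : Finset G) (ω : G → S) :
    |hamiltonian Φ Λ ω| ≤ energyBound Φ Λ :=
  tsum_of_norm_bounded (summable_supNorm hΦ Λ).hasSum fun A => norm_toFun_le hΦ A ω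

lemma Potential.toFun_congr (A : Finset G) {ω ω₂ : G → S} (h : ∀ i ∈ A, ω i = ω₂ i) :
    Φ.toFun A ω = Φ.toFun A ω₂ :=
  dependsOn_of_measurable_cylinderEvents (Φ.measurable_toFun A) h

include hΦ in
lemma measurable_hamiltonian [Countable G] (Λ : Finset G) : Measurable (hamiltonian Φ Λ) := by
  have h (ω : G → S) := (summable_toFun hΦ Λ ω).hasSum
  refine measurable_of_tendsto_metrizable' Filter.atTop
    (f := fun (s : Finset {A : Finset G // ∃ i ∈ Λ, i ∈ A}) ω => ∑ A ∈ s, Φ.toFun A.1 ω)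
    (fun s => ?_) (tendsto_pi_nhds.2 fun ω => h ω)
  exact Finset.measurable_fun_sum s fun A _ =>
    (Φ.measurable_toFun A.1).mono cylinderEvents_le_pi le_rfl

-- Interaction terms that miss `Λ` do not see the change from `ω` to `ω₂` and cancel.
include hΦ in
lemma hamiltonian_sub_hamiltonian {Λ Δ : Finset G} (h : Λ ⊆ Δ) {ω ω₂ : G → S}
    (hω : ∀ i ∉ Λ, ω i = ω₂ i) :
    hamiltonian Φ Δ ω - hamiltonian Φ Δ ω₂ = hamiltonian Φ Λ ω - hamiltonian Φ Λ ω₂ := by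
  have h1 (Λ : Finset G) : hamiltonian Φ Λ ω - hamiltonian Φ Λ ω₂ =
      ∑' A, Set.indicator {A : Finset G | ∃ i ∈ Λ, i ∈ A}
        (fun A => Φ.toFun A ω - Φ.toFun A ω₂) A := by
    rw [hamiltonian, hamiltonian, ← (summable_toFun hΦ Λ ω).tsum_sub (summable_toFun hΦ Λ ω₂)]
    exact tsum_subtype {A : Finset G | ∃ i ∈ Λ, i ∈ A} fun A => Φ.toFun A ω - Φ.toFun A ω₂
  rw [h1, h1]
  refine tsum_congr fun A => ?_
  by_cases hA : ∃ i ∈ Λ, i ∈ A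
  · have hA' : ∃ i ∈ Δ, i ∈ A := by obtain ⟨i, hi, hiA⟩ := hA; exact ⟨i, h hi, hiA⟩
    rw [Set.indicator_of_mem (by exact hA'), Set.indicator_of_mem (by exact hA)]
  · have h0 : Φ.toFun A ω - Φ.toFun A ω₂ = 0 := by
      rw [sub_eq_zero]
      exact Φ.toFun_congr A fun i hi => hω i fun hiΛ => hA ⟨i, hiΛ, hi⟩
    simp [Set.indicator, h0]

-- Quasilocality: each term is eventually constant, and the norms give a summable dominating series.
include hΦ in
lemma tendsto_hamiltonian {ι : Type*} {l : Filter ι} (Λ : Finset G) {x : ι → G → S} {ω : G → S}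
    (hx : ∀ j, ∀ᶠ k in l, x k j = ω j) :
    Filter.Tendsto (fun k => hamiltonian Φ Λ (x k)) l (nhds (hamiltonian Φ Λ ω)) := by
  refine tendsto_tsum_of_dominated_convergence (summable_supNorm hΦ Λ) (fun A => ?_)
    (Filter.Eventually.of_forall fun k A => norm_toFun_le hΦ A _)
  refine tendsto_const_nhds.congr' ?_
  have : ∀ᶠ k in l, ∀ j ∈ A.1, x k j = ω j := (Filter.eventually_all_finset A.1).2 fun j _ => hx j
  filter_upwards [this] with k hk
  exact (Φ.toFun_congr A.1 hk).symm

variable (Φ) in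
/-- The Boltzmann factor of the volume `Λ`. -/
noncomputable def boltzmann (Λ : Finset G) (ω : G → S) : ℝ≥0∞ :=
  ENNReal.ofReal (Real.exp (-hamiltonian Φ Λ ω))

lemma boltzmann_ne_zero (Λ : Finset G) (ω : G → S) : boltzmann Φ Λ ω ≠ 0 := by
  simp [boltzmann, Real.exp_pos]

lemma boltzmann_ne_top (Λ : Finset G) (ω : G → S) : boltzmann Φ Λ ω ≠ ∞ :=
  ENNReal.ofReal_ne_top

include hΦ in
lemma boltzmann_le (Λ : Finset G) (ω : G → S) :
    boltzmann Φ Λ ω ≤ ENNReal.ofReal (Real.exp (energyBound Φ Λ)) :=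
  ENNReal.ofReal_le_ofReal (Real.exp_le_exp.2 (neg_le.1 (abs_le.1 (abs_hamiltonian_le hΦ Λ ω)).1))

include hΦ in
lemma le_boltzmann (Λ : Finset G) (ω : G → S) :
    ENNReal.ofReal (Real.exp (-energyBound Φ Λ)) ≤ boltzmann Φ Λ ω :=
  ENNReal.ofReal_le_ofReal
    (Real.exp_le_exp.2 (neg_le_neg (abs_le.1 (abs_hamiltonian_le hΦ Λ ω)).2))

include hΦ in
lemma measurable_boltzmann [Countable G] (Λ : Finset G) : Measurable (boltzmann Φ Λ) :=
  (Real.measurable_exp.comp (measurable_hamiltonian hΦ Λ).neg).ennreal_ofReal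

include hΦ in
lemma boltzmann_mul_boltzmann {Λ Δ : Finset G} (h : Λ ⊆ Δ) {ω ω₂ : G → S}
    (hω : ∀ i ∉ Λ, ω i = ω₂ i) :
    boltzmann Φ Δ ω * boltzmann Φ Λ ω₂ = boltzmann Φ Δ ω₂ * boltzmann Φ Λ ω := by
  have := hamiltonian_sub_hamiltonian hΦ h hω
  simp only [boltzmann]
  rw [← ENNReal.ofReal_mul (Real.exp_pos _).le, ← ENNReal.ofReal_mul (Real.exp_pos _).le,
    ← Real.exp_add, ← Real.exp_add]
  congr 2
  linarith

include hΦ in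
lemma tendsto_boltzmann {ι : Type*} {l : Filter ι} (Λ : Finset G) {x : ι → G → S} {ω : G → S}
    (hx : ∀ j, ∀ᶠ k in l, x k j = ω j) :
    Filter.Tendsto (fun k => boltzmann Φ Λ (x k)) l (nhds (boltzmann Φ Λ ω)) :=
  ENNReal.tendsto_ofReal
    ((Real.continuous_exp.tendsto _).comp (tendsto_hamiltonian hΦ Λ hx).neg)

end Hamiltonian

/-! ### The constrained specification and its consistency. -/

section Specification

open scoped Classical in
lemma lmarginal_mul_of_dependsOn_compl {G S : Type*} [MeasurableSpace S] (α : G → Measure S)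
    {Λ : Finset G} {f g : (G → S) → ℝ≥0∞} (hf : Measurable f)
    (hg : ∀ ω ω₂ : G → S, (∀ i ∉ Λ, ω i = ω₂ i) → g ω = g ω₂) (η : G → S) :
    lmarginal α Λ (fun ω => g ω * f ω) η = g η * lmarginal α Λ f η := by
  simp only [lmarginal]
  refine Eq.trans ?_ (lintegral_const_mul _ (hf.comp measurable_updateFinset))
  refine lintegral_congr fun y => ?_
  rw [hg (Function.updateFinset η Λ y) η fun i hi => by simp [Function.updateFinset, hi]]

/-- The restriction of the a priori measure to the spins whose colour is prescribed by `ω'`. -/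
noncomputable def colorMeasure {G S : Type*} [MeasurableSpace S] (lam : Measure S) {q : ℕ}
    (T : S → Fin q) (ω' : G → Fin q) (i : G) : Measure S :=
  lam.restrict (T ⁻¹' {ω' i})

instance {G S : Type*} [MeasurableSpace S] (lam : Measure S) [IsFiniteMeasure lam] {q : ℕ}
    (T : S → Fin q) (ω' : G → Fin q) (i : G) : IsFiniteMeasure (colorMeasure lam T ω' i) := by
  unfold colorMeasure; infer_instance

variable {G S : Type*} [MeasurableSpace S] {Φ : Potential G S}
  {lam : Measure S} [IsFiniteMeasure lam] {q : ℕ} {T : S → Fin q} (hT : Measurable T)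

-- The colour constraint is absorbed into a site-dependent reference measure, so that the
-- constrained specification becomes an ordinary Gibbsian one.
include hT in
open scoped Classical in
lemma lmarginal_indicator_color (ω' : G → Fin q) (Λ : Finset G) (f : (G → S) → ℝ≥0∞) (η : G → S) :
    lmarginal (fun _ => lam) Λ ({ω | ∀ i ∈ Λ, T (ω i) = ω' i}.indicator f) η =
      lmarginal (colorMeasure lam T ω') Λ f η := by
  have hset : MeasurableSet (Set.univ.pi fun i : Λ => T ⁻¹' {ω' i}) :=
    MeasurableSet.univ_pi fun i => hT (measurableSet_singleton _)
  simp only [lmarginal, colorMeasure]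
  rw [← Measure.restrict_pi_pi, ← lintegral_indicator hset]
  refine lintegral_congr fun y => ?_
  have : Function.updateFinset η Λ y ∈ {ω : G → S | ∀ i ∈ Λ, T (ω i) = ω' i} ↔
      y ∈ Set.univ.pi fun i : Λ => T ⁻¹' {ω' i} := by
    simp only [Set.mem_ofPred_eq, Set.mem_pi, Set.mem_univ, true_imp_iff, Subtype.forall]
    refine forall₂_congr fun i hi => ?_
    simp [Function.updateFinset, hi]
  by_cases hy : y ∈ Set.univ.pi fun i : Λ => T ⁻¹' {ω' i}
  · rw [Set.indicator_of_mem hy, Set.indicator_of_mem (this.2 hy)]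
  · rw [Set.indicator_of_notMem hy, Set.indicator_of_notMem (mt this.1 hy)]

include hT in
open scoped Classical in
/-- Monotonicity of marginal integrals only tests configurations of the prescribed colours. -/
lemma lmarginal_color_mono (ω' : G → Fin q) {Λ : Finset G} {f g : (G → S) → ℝ≥0∞} {η η₂ : G → S}
    (h : ∀ y : Λ → S, (∀ i, T (y i) = ω' i) →
      f (Function.updateFinset η Λ y) ≤ g (Function.updateFinset η₂ Λ y)) :
    lmarginal (colorMeasure lam T ω') Λ f η ≤ lmarginal (colorMeasure lam T ω') Λ g η₂ := by
  have hset : MeasurableSet (Set.univ.pi fun i : Λ => T ⁻¹' {ω' i}) :=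
    MeasurableSet.univ_pi fun i => hT (measurableSet_singleton _)
  simp only [lmarginal, colorMeasure]
  rw [← Measure.restrict_pi_pi]
  refine lintegral_mono_ae ((ae_restrict_mem hset).mono fun y hy => h y fun i => ?_)
  exact hy i (Set.mem_univ i)

variable [Countable G] (hΦ : AbsolutelySummable Φ)

variable (Φ lam T) in
open scoped Classical in
/-- The partition function of the constrained specification. -/
noncomputable def partitionFunction (ω' : G → Fin q) (Λ : Finset G) (η : G → S) : ℝ≥0∞ :=
  lmarginal (colorMeasure lam T ω') Λ (boltzmann Φ Λ) η

include hΦ in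
omit [IsFiniteMeasure lam] in
open scoped Classical in
lemma lintegral_gibbsWeight {Λ : Finset G} {η : G → S} {f : (G → S) → ℝ≥0∞} (hf : Measurable f) :
    ∫⁻ ω, f ω ∂gibbsWeight Φ lam Λ η =
      lmarginal (fun _ => lam) Λ (fun ω => boltzmann Φ Λ ω * f ω) η := by
  rw [gibbsWeight, lintegral_map hf measurable_updateFinset]
  exact lintegral_withDensity_eq_lintegral_mul _
    ((measurable_boltzmann hΦ Λ).comp measurable_updateFinset) (hf.comp measurable_updateFinset)

include hΦ in
lemma measurable_partitionFunction (ω' : G → Fin q) (Λ : Finset G) :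
    Measurable (partitionFunction Φ lam T ω' Λ) := by
  classical
  exact (measurable_boltzmann hΦ Λ).lmarginal _

omit [Countable G] in
include hΦ in
lemma partitionFunction_le (ω' : G → Fin q) (Λ : Finset G) (η : G → S) :
    partitionFunction Φ lam T ω' Λ η ≤
      ENNReal.ofReal (Real.exp (energyBound Φ Λ)) * ∏ i : Λ, lam (T ⁻¹' {ω' i}) := by
  classical
  simp only [partitionFunction, lmarginal]
  refine (lintegral_mono fun y => boltzmann_le hΦ Λ _).trans (le_of_eq ?_)
  rw [lintegral_const, Measure.pi_univ]
  simp [colorMeasure]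

omit [Countable G] in
include hΦ in
lemma le_partitionFunction (ω' : G → Fin q) (Λ : Finset G) (η : G → S) :
    ENNReal.ofReal (Real.exp (-energyBound Φ Λ)) * ∏ i : Λ, lam (T ⁻¹' {ω' i}) ≤
      partitionFunction Φ lam T ω' Λ η := by
  classical
  simp only [partitionFunction, lmarginal]
  refine le_trans (le_of_eq ?_) (lintegral_mono fun y => le_boltzmann hΦ Λ _)
  rw [lintegral_const, Measure.pi_univ]
  simp [colorMeasure]

variable (hpos : ∀ k : Fin q, 0 < lam (T ⁻¹' {k}))

omit [Countable G] in
include hΦ in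
lemma partitionFunction_ne_top (ω' : G → Fin q) (Λ : Finset G) (η : G → S) :
    partitionFunction Φ lam T ω' Λ η ≠ ∞ :=
  ne_top_of_le_ne_top (ENNReal.mul_ne_top ENNReal.ofReal_ne_top
    (ENNReal.prod_ne_top fun _ _ => measure_ne_top _ _)) (partitionFunction_le hΦ ω' Λ η)

omit [Countable G] in
include hΦ hpos in
lemma partitionFunction_ne_zero (ω' : G → Fin q) (Λ : Finset G) (η : G → S) :
    partitionFunction Φ lam T ω' Λ η ≠ 0 := by
  refine fun h => (mul_ne_zero ?_ ?_) (le_zero_iff.1 (h ▸ le_partitionFunction hΦ ω' Λ η))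
  · simp [Real.exp_pos]
  · exact Finset.prod_ne_zero_iff.2 fun i _ => (hpos _).ne'

omit [Countable G] [IsFiniteMeasure lam] in
lemma partitionFunction_congr (ω' : G → Fin q) (Λ : Finset G) {η η₂ : G → S}
    (h : ∀ i ∉ Λ, η i = η₂ i) :
    partitionFunction Φ lam T ω' Λ η = partitionFunction Φ lam T ω' Λ η₂ := by
  classical
  exact lmarginal_congr _ _ h

include hT hΦ hpos in
open scoped Classical in
lemma lintegral_constrainedSpec (ω' : G → Fin q) (Λ : Finset G) (η : G → S)
    {f : (G → S) → ℝ≥0∞} (hf : Measurable f) :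
    ∫⁻ ω, f ω ∂constrainedSpec Φ lam T ω' Λ η =
      (partitionFunction Φ lam T ω' Λ η)⁻¹ *
        lmarginal (colorMeasure lam T ω') Λ (fun ω => boltzmann Φ Λ ω * f ω) η := by
  set E : Set (G → S) := {ω | ∀ i ∈ Λ, T (ω i) = ω' i} with hE
  have hEm : MeasurableSet E := by
    have : E = ⋂ i ∈ Λ, (fun ω : G → S => T (ω i)) ⁻¹' {ω' i} := by ext; simp [hE]
    rw [this]
    exact Finset.measurableSet_biInter _ fun i _ =>
      (hT.comp (measurable_pi_apply i)) (measurableSet_singleton _)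
  have hW (g : (G → S) → ℝ≥0∞) (hg : Measurable g) :
      ∫⁻ ω in E, g ω ∂gibbsWeight Φ lam Λ η =
        lmarginal (colorMeasure lam T ω') Λ (fun ω => boltzmann Φ Λ ω * g ω) η := by
    rw [← lmarginal_indicator_color hT, ← lintegral_indicator hEm,
      lintegral_gibbsWeight hΦ (hg.indicator hEm)]
    congr 1
    ext ω
    by_cases hω : ω ∈ E
    · rw [Set.indicator_of_mem hω, Set.indicator_of_mem (by exact hω)]
    · rw [Set.indicator_of_notMem hω, Set.indicator_of_notMem (by exact hω), mul_zero]
  have hWE : gibbsWeight Φ lam Λ η E = partitionFunction Φ lam T ω' Λ η := by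
    have := hW (fun _ => 1) measurable_const
    simpa [partitionFunction] using this
  have hZ0 := partitionFunction_ne_zero hΦ hpos ω' Λ η
  -- The unconstrained normalisation is positive and finite, hence cancels in the conditioning.
  have hc0 : (gibbsWeight Φ lam Λ η Set.univ)⁻¹ ≠ ∞ := by
    rw [ENNReal.inv_ne_top]
    exact fun h => hZ0 (hWE ▸ measure_mono_null (Set.subset_univ _) h)
  have hctop : (gibbsWeight Φ lam Λ η Set.univ)⁻¹ ≠ 0 := by
    rw [ENNReal.inv_ne_zero]
    have h1 := lintegral_gibbsWeight (lam := lam) (Λ := Λ) (η := η) hΦ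
      (measurable_const (a := (1 : ℝ≥0∞)))
    rw [lintegral_one] at h1
    rw [h1]
    simp only [lmarginal, mul_one]
    refine ne_top_of_le_ne_top ?_ (lintegral_mono fun y => boltzmann_le hΦ Λ _)
    rw [lintegral_const]
    exact ENNReal.mul_ne_top ENNReal.ofReal_ne_top (measure_ne_top _ _)
  rw [constrainedSpec, ProbabilityTheory.cond, gibbsSpec, Measure.restrict_smul,
    lintegral_smul_measure, lintegral_smul_measure, hW f hf, Measure.smul_apply, hWE]
  simp only [smul_eq_mul]
  rw [ENNReal.mul_inv (Or.inl hctop) (Or.inl hc0), ← mul_assoc]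
  congr 1
  rw [mul_comm, ← mul_assoc, ENNReal.mul_inv_cancel hctop hc0, one_mul]

include hT hΦ hpos in
lemma isProbabilityMeasure_constrainedSpec (ω' : G → Fin q) (Λ : Finset G) (η : G → S) :
    IsProbabilityMeasure (constrainedSpec Φ lam T ω' Λ η) := by
  classical
  refine ⟨?_⟩
  rw [← lintegral_one, lintegral_constrainedSpec hT hΦ hpos ω' Λ η measurable_const]
  simp only [mul_one]
  exact ENNReal.inv_mul_cancel (partitionFunction_ne_zero hΦ hpos ω' Λ η)
    (partitionFunction_ne_top hΦ ω' Λ η)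

include hT hΦ hpos in
lemma measurable_lintegral_constrainedSpec (ω' : G → Fin q) (Λ : Finset G)
    {f : (G → S) → ℝ≥0∞} (hf : Measurable f) :
    Measurable fun η => ∫⁻ ω, f ω ∂constrainedSpec Φ lam T ω' Λ η := by
  classical
  simp_rw [lintegral_constrainedSpec hT hΦ hpos ω' Λ _ hf]
  exact (measurable_partitionFunction hΦ ω' Λ).inv.mul
    (((measurable_boltzmann hΦ Λ).mul hf).lmarginal _)

include hT hΦ hpos in
lemma lintegral_constrainedSpec_congr (ω' : G → Fin q) (Λ : Finset G) {η η₂ : G → S}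
    (h : ∀ i ∉ Λ, η i = η₂ i) {f : (G → S) → ℝ≥0∞} (hf : Measurable f) :
    ∫⁻ ω, f ω ∂constrainedSpec Φ lam T ω' Λ η = ∫⁻ ω, f ω ∂constrainedSpec Φ lam T ω' Λ η₂ := by
  classical
  rw [lintegral_constrainedSpec hT hΦ hpos ω' Λ _ hf,
    lintegral_constrainedSpec hT hΦ hpos ω' Λ _ hf, partitionFunction_congr ω' Λ h,
    lmarginal_congr _ _ h]

include hT hΦ hpos in
open scoped Classical in
lemma lintegral_constrainedSpec_mono (ω' : G → Fin q) (Λ : Finset G) (η : G → S)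
    {f g : (G → S) → ℝ≥0∞} (hf : Measurable f) (hg : Measurable g)
    (h : ∀ y : Λ → S, (∀ i, T (y i) = ω' i) →
      f (Function.updateFinset η Λ y) ≤ g (Function.updateFinset η Λ y)) :
    ∫⁻ ω, f ω ∂constrainedSpec Φ lam T ω' Λ η ≤ ∫⁻ ω, g ω ∂constrainedSpec Φ lam T ω' Λ η := by
  rw [lintegral_constrainedSpec hT hΦ hpos ω' Λ _ hf,
    lintegral_constrainedSpec hT hΦ hpos ω' Λ _ hg]
  gcongr 1
  exact lmarginal_color_mono hT ω' fun y hy => by gcongr; exact h y hy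

include hT hΦ hpos in
open scoped Classical in
lemma ae_constrainedSpec_of_compl {ω' : G → Fin q} {Λ : Finset G} {η : G → S}
    (hη : ∀ i ∉ Λ, T (η i) = ω' i) :
    ∀ᵐ ω ∂constrainedSpec Φ lam T ω' Λ η, ∀ i, T (ω i) = ω' i := by
  have hm : MeasurableSet {ω : G → S | ∀ i, T (ω i) = ω' i}ᶜ := by
    refine MeasurableSet.compl ?_
    rw [Set.ofPred_forall]
    exact .iInter fun i => (hT.comp (measurable_pi_apply i)) (measurableSet_singleton _)
  rw [ae_iff]
  change (constrainedSpec Φ lam T ω' Λ η) {ω | ∀ i, T (ω i) = ω' i}ᶜ = 0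
  rw [← lintegral_indicator_one hm, ← le_zero_iff]
  have h0 := isProbabilityMeasure_constrainedSpec hT hΦ hpos ω' Λ η
  calc _ ≤ ∫⁻ ω, 0 ∂constrainedSpec Φ lam T ω' Λ η := by
        refine lintegral_constrainedSpec_mono hT hΦ hpos ω' Λ η (measurable_one.indicator hm)
          measurable_const fun y hy => ?_
        rw [Set.indicator_of_notMem]
        simp only [Set.mem_compl_iff, Set.mem_ofPred_eq, not_not]
        intro i
        by_cases hi : i ∈ Λ
        · simpa [Function.updateFinset, hi] using hy ⟨i, hi⟩
        · simpa [Function.updateFinset, hi] using hη i hi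
    _ = 0 := by simp

include hT hΦ hpos in
lemma ae_constrainedSpec {ω' : G → Fin q} {Λ : Finset G} {η : G → S}
    (hη : ∀ i, T (η i) = ω' i) :
    ∀ᵐ ω ∂constrainedSpec Φ lam T ω' Λ η, ∀ i, T (ω i) = ω' i :=
  ae_constrainedSpec_of_compl hT hΦ hpos fun i _ => hη i

omit [IsFiniteMeasure lam] in
include hΦ in
open scoped Classical in
/-- The Boltzmann factors of nested volumes differ, as functions of the spins in the smaller
volume, by a constant. -/
lemma lmarginal_boltzmann_of_subset (α : G → Measure S) {Λ Δ : Finset G}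
    (h : Λ ⊆ Δ) {f : (G → S) → ℝ≥0∞} (hf : Measurable f) (η : G → S) :
    lmarginal α Λ (fun ω => boltzmann Φ Δ ω * f ω) η =
      boltzmann Φ Δ η / boltzmann Φ Λ η *
        lmarginal α Λ (fun ω => boltzmann Φ Λ ω * f ω) η := by
  simp only [lmarginal]
  refine Eq.trans ?_ (lintegral_const_mul _
    (((measurable_boltzmann hΦ Λ).mul hf).comp measurable_updateFinset))
  refine lintegral_congr fun y => ?_
  rw [← mul_assoc]
  congr 1
  have h1 := boltzmann_mul_boltzmann hΦ h (ω := Function.updateFinset η Λ y) (ω₂ := η)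
    fun i hi => by simp [Function.updateFinset, hi]
  rw [ENNReal.div_eq_inv_mul, mul_assoc, ← h1, mul_comm, mul_assoc,
    ENNReal.mul_inv_cancel (boltzmann_ne_zero Λ η) (boltzmann_ne_top Λ η), mul_one]

-- It suffices to compare the integrals over `Λ`. There the two Boltzmann factors differ by a
-- constant, and the inner expectation does not depend on the spins in `Λ`, so integrating it
-- produces a partition function that cancels its denominator.
include hT hΦ hpos in
open scoped Classical in
lemma lmarginal_boltzmann_mul_lintegral (ω' : G → Fin q) {Λ Δ : Finset G} (h : Λ ⊆ Δ)
    {f : (G → S) → ℝ≥0∞} (hf : Measurable f) :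
    lmarginal (colorMeasure lam T ω') Δ (fun ω => boltzmann Φ Δ ω *
        ∫⁻ ξ, f ξ ∂constrainedSpec Φ lam T ω' Λ ω) =
      lmarginal (colorMeasure lam T ω') Δ (fun ω => boltzmann Φ Δ ω * f ω) := by
  have hg := measurable_lintegral_constrainedSpec (lam := lam) (T := T) hT hΦ hpos ω' Λ hf
  have hw := measurable_boltzmann hΦ Δ
  refine lmarginal_eq_of_subset h (hw.mul hg) (hw.mul hf) ?_
  ext η
  rw [lmarginal_boltzmann_of_subset hΦ _ h hg, lmarginal_boltzmann_of_subset hΦ _ h hf]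
  congr 1
  simp_rw [mul_comm (boltzmann Φ Λ _) (∫⁻ ξ, f ξ ∂_)]
  rw [lmarginal_mul_of_dependsOn_compl _ (measurable_boltzmann hΦ Λ)
    fun ω ω₂ hω => lintegral_constrainedSpec_congr hT hΦ hpos ω' Λ hω hf,
    lintegral_constrainedSpec hT hΦ hpos ω' Λ η hf, mul_comm, ← mul_assoc]
  change partitionFunction Φ lam T ω' Λ η * _ * _ = _
  rw [ENNReal.mul_inv_cancel (partitionFunction_ne_zero hΦ hpos ω' Λ η)
    (partitionFunction_ne_top hΦ ω' Λ η), one_mul]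

include hT hΦ hpos in
/-- Consistency of the constrained specification. -/
lemma lintegral_constrainedSpec_lintegral (ω' : G → Fin q) {Λ Δ : Finset G} (h : Λ ⊆ Δ)
    {f : (G → S) → ℝ≥0∞} (hf : Measurable f) (η : G → S) :
    ∫⁻ ω, ∫⁻ ξ, f ξ ∂constrainedSpec Φ lam T ω' Λ ω ∂constrainedSpec Φ lam T ω' Δ η =
      ∫⁻ ω, f ω ∂constrainedSpec Φ lam T ω' Δ η := by
  classical
  rw [lintegral_constrainedSpec hT hΦ hpos ω' Δ η hf, lintegral_constrainedSpec hT hΦ hpos ω' Δ η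
    (measurable_lintegral_constrainedSpec hT hΦ hpos ω' Λ hf),
    lmarginal_boltzmann_mul_lintegral hT hΦ hpos ω' h hf]

end Specification

/-! ### The Dobrushin contraction for the constrained specification. -/

section Dobrushin

open scoped Classical in
/-- On configurations of the colours `ω'`, the function `f` is Lipschitz with respect to the
Hamming distance weighted by the vector `a`. -/
def HammingBound {G S : Type*} {q : ℕ} (T : S → Fin q) (ω' : G → Fin q) (f : (G → S) → ℝ≥0∞)
    (a : G → ℝ≥0∞) : Prop :=
  ∀ ω ω₂ : G → S, (∀ i, T (ω i) = ω' i) → (∀ i, T (ω₂ i) = ω' i) →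
    f ω ≤ f ω₂ + ∑' j, if ω j = ω₂ j then 0 else a j

lemma HammingBound.le_add_tsum {G S : Type*} {q : ℕ} {T : S → Fin q} {ω' : G → Fin q}
    {f : (G → S) → ℝ≥0∞} {a : G → ℝ≥0∞} (h : HammingBound T ω' f a) {ω ω₂ : G → S}
    (hω : ∀ i, T (ω i) = ω' i) (hω₂ : ∀ i, T (ω₂ i) = ω' i) : f ω ≤ f ω₂ + ∑' j, a j := by
  classical
  refine (h ω ω₂ hω hω₂).trans ?_
  gcongr
  split_ifs <;> simp

-- Two configurations that differ somewhere in `D` already have weighted distance at least `1`.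
open scoped Classical in
lemma hammingBound_of_dependsOn {G S : Type*} {q : ℕ} (T : S → Fin q) (ω' : G → Fin q)
    {f : (G → S) → ℝ≥0∞} {D : Finset G} (hf : DependsOn f (D : Set G)) (hf1 : ∀ ω, f ω ≤ 1) :
    HammingBound T ω' f fun j => if j ∈ D then 1 else 0 := by
  intro ω ω₂ _ _
  by_cases h : ∀ j ∈ D, ω j = ω₂ j
  · rw [hf h]; exact le_self_add
  · push Not at h
    obtain ⟨j, hj, hne⟩ := h
    refine (hf1 ω).trans (le_add_left (le_trans ?_ (ENNReal.le_tsum j)))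
    simp [hj, hne]

variable {G S : Type*} [Countable G] [MeasurableSpace S] {Φ : Potential G S}
  {lam : Measure S} [IsFiniteMeasure lam] {q : ℕ} {T : S → Fin q} (hT : Measurable T)
  (hΦ : AbsolutelySummable Φ) (hpos : ∀ k : Fin q, 0 < lam (T ⁻¹' {k}))

include hT hΦ hpos in
open scoped Classical in
lemma tendsto_lintegral_constrainedSpec {ι : Type*} {l : Filter ι} [l.IsCountablyGenerated]
    (ω' : G → Fin q) (Λ : Finset G) {x : ι → G → S} {ω : G → S}
    (hx : ∀ j, ∀ᶠ k in l, x k j = ω j) {f : (G → S) → ℝ≥0∞} (hf : Measurable f)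
    (hf1 : ∀ ω, f ω ≤ 1)
    (hlim : ∀ y : Λ → S, Filter.Tendsto (fun k => f (Function.updateFinset (x k) Λ y)) l
      (nhds (f (Function.updateFinset ω Λ y)))) :
    Filter.Tendsto (fun k => ∫⁻ ξ, f ξ ∂constrainedSpec Φ lam T ω' Λ (x k)) l
      (nhds (∫⁻ ξ, f ξ ∂constrainedSpec Φ lam T ω' Λ ω)) := by
  have key (g : (G → S) → ℝ≥0∞) (hg : Measurable g) (hg1 : ∀ ω, g ω ≤ 1)
      (hglim : ∀ y : Λ → S, Filter.Tendsto (fun k => g (Function.updateFinset (x k) Λ y)) l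
        (nhds (g (Function.updateFinset ω Λ y)))) :
      Filter.Tendsto (fun k => lmarginal (colorMeasure lam T ω') Λ
        (fun ω => boltzmann Φ Λ ω * g ω) (x k)) l
        (nhds (lmarginal (colorMeasure lam T ω') Λ (fun ω => boltzmann Φ Λ ω * g ω) ω)) := by
    simp only [lmarginal]
    refine tendsto_lintegral_filter_of_dominated_convergence
      (fun _ => ENNReal.ofReal (Real.exp (energyBound Φ Λ))) (.of_forall fun k =>
        ((measurable_boltzmann hΦ Λ).mul hg).comp measurable_updateFinset)
      (.of_forall fun k => .of_forall fun y => ?_) ?_ (.of_forall fun y => ?_)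
    · simpa using mul_le_mul' (boltzmann_le hΦ Λ (Function.updateFinset (x k) Λ y)) (hg1 _)
    · rw [lintegral_const]
      exact ENNReal.mul_ne_top ENNReal.ofReal_ne_top (measure_ne_top _ _)
    · refine ENNReal.Tendsto.mul (tendsto_boltzmann hΦ Λ fun j => ?_)
        (Or.inl (boltzmann_ne_zero _ _)) (hglim y) (Or.inr (boltzmann_ne_top _ _))
      by_cases hj : j ∈ Λ
      · simp [Function.updateFinset, hj]
      · simpa [Function.updateFinset, hj] using hx j
  simp_rw [lintegral_constrainedSpec hT hΦ hpos ω' Λ _ hf]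
  have hZ := key (fun _ => 1) measurable_const (fun _ => le_rfl) fun y => tendsto_const_nhds
  simp only [mul_one] at hZ
  refine ENNReal.Tendsto.mul (tendsto_inv_iff.2 hZ)
    (Or.inl (ENNReal.inv_ne_zero.2 (partitionFunction_ne_top hΦ ω' Λ ω))) (key f hf hf1 hlim)
    (Or.inr (ENNReal.inv_ne_top.2 (partitionFunction_ne_zero hΦ hpos ω' Λ ω)))

variable (Φ lam T) in
/-- The marginal at the site `i` of the constrained single-site kernel. -/
noncomputable def siteMarginal (ω' : G → Fin q) (i : G) (ω : G → S) : Measure S :=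
  (constrainedSpec Φ lam T ω' {i} ω).map fun σ => σ i

include hT hΦ hpos in
lemma isProbabilityMeasure_siteMarginal (ω' : G → Fin q) (i : G) (ω : G → S) :
    IsProbabilityMeasure (siteMarginal Φ lam T ω' i ω) := by
  have := isProbabilityMeasure_constrainedSpec hT hΦ hpos ω' {i} ω
  exact Measure.isProbabilityMeasure_map (measurable_pi_apply i).aemeasurable

include hT hΦ hpos in
open scoped Classical in
lemma lintegral_constrainedSpec_singleton (ω' : G → Fin q) (i : G) (ω : G → S)
    {f : (G → S) → ℝ≥0∞} (hf : Measurable f) :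
    ∫⁻ ξ, f ξ ∂constrainedSpec Φ lam T ω' {i} ω =
      ∫⁻ s, f (Function.update ω i s) ∂siteMarginal Φ lam T ω' i ω := by
  have hg : Measurable fun s => f (Function.update ω i s) := hf.comp (measurable_update ω)
  rw [siteMarginal, lintegral_map hg (measurable_pi_apply i)]
  have hy (y : ({i} : Finset G) → S) : f (Function.updateFinset ω {i} y) =
      f (Function.update ω i (Function.updateFinset ω {i} y i)) := by
    congr 1
    ext k
    by_cases hk : k = i
    · subst hk; simp
    · simp [Function.updateFinset, hk]
  exact le_antisymm
    (lintegral_constrainedSpec_mono hT hΦ hpos ω' {i} ω hf (hg.comp (measurable_pi_apply i))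
      fun y _ => (hy y).le)
    (lintegral_constrainedSpec_mono hT hΦ hpos ω' {i} ω (hg.comp (measurable_pi_apply i)) hf
      fun y _ => (hy y).ge)

include hT hΦ hpos in
lemma ae_siteMarginal {ω' : G → Fin q} (i : G) {ω : G → S} (hω : ∀ i, T (ω i) = ω' i) :
    ∀ᵐ s ∂siteMarginal Φ lam T ω' i ω, s ∈ T ⁻¹' {ω' i} := by
  change T ⁻¹' {ω' i} ∈ ae (Measure.map (fun σ : G → S => σ i) _)
  rw [mem_ae_map_iff (measurable_pi_apply i).aemeasurable (hT (measurableSet_singleton _))]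
  exact (ae_constrainedSpec hT hΦ hpos hω).mono fun σ hσ => hσ i

include hT hΦ hpos in
lemma siteMarginal_le_of_eq_off {ω' : G → Fin q} (i j : G) {ω ω₂ : G → S}
    (hω : ∀ i, T (ω i) = ω' i) (hω₂ : ∀ i, T (ω₂ i) = ω' i) (h : ∀ k, k ≠ j → ω k = ω₂ k)
    {B : Set S} (hB : MeasurableSet B) :
    siteMarginal Φ lam T ω' i ω B ≤
      siteMarginal Φ lam T ω' i ω₂ B + dobrushinMatrix Φ lam T i j := by
  have h1 := isProbabilityMeasure_siteMarginal hT hΦ hpos ω' i ω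
  have h2 := isProbabilityMeasure_siteMarginal hT hΦ hpos ω' i ω₂
  have hle : ENNReal.ofReal |(siteMarginal Φ lam T ω' i ω).real B -
      (siteMarginal Φ lam T ω' i ω₂).real B| ≤ dobrushinMatrix Φ lam T i j := by
    refine le_trans ?_ (le_iSup_of_le ω' (le_iSup_of_le ω (le_iSup_of_le ω₂
      (le_iSup_of_le h (le_iSup_of_le hω (le_iSup_of_le hω₂ le_rfl))))))
    exact le_iSup₂_of_le (f := fun (B : Set S) (_ : MeasurableSet B) =>
      ENNReal.ofReal |(siteMarginal Φ lam T ω' i ω).real B -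
        (siteMarginal Φ lam T ω' i ω₂).real B|) B hB le_rfl
  refine le_trans ?_ (add_le_add_right hle _)
  rw [← ofReal_measureReal, ← ofReal_measureReal, ← ENNReal.ofReal_add (by positivity)
    (by positivity)]
  have habs := le_abs_self
    ((siteMarginal Φ lam T ω' i ω).real B - (siteMarginal Φ lam T ω' i ω₂).real B)
  exact ENNReal.ofReal_le_ofReal (by linarith)

-- The matrix only compares configurations differing at one site. Finitely many sites are changed
-- one after another, staying within the colours `ω'`; quasilocality then takes the finite set to
-- all of `G`.
include hT hΦ hpos in
open scoped Classical in
lemma siteMarginal_le_add_tsum {ω' : G → Fin q} (i : G) {ω ω₂ : G → S}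
    (hω : ∀ i, T (ω i) = ω' i) (hω₂ : ∀ i, T (ω₂ i) = ω' i) {B : Set S} (hB : MeasurableSet B) :
    siteMarginal Φ lam T ω' i ω B ≤ siteMarginal Φ lam T ω' i ω₂ B +
      ∑' j, if ω j = ω₂ j then 0 else dobrushinMatrix Φ lam T i j := by
  set x : Finset G → G → S := fun F k => if k ∈ F then ω₂ k else ω k with hx
  have hxT (F : Finset G) (k : G) : T (x F k) = ω' k := by
    by_cases hk : k ∈ F <;> simp [hx, hk, hω, hω₂]
  have hfin (F : Finset G) : siteMarginal Φ lam T ω' i ω B ≤ siteMarginal Φ lam T ω' i (x F) B +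
      ∑ j ∈ F, if ω j = ω₂ j then 0 else dobrushinMatrix Φ lam T i j := by
    induction F using Finset.induction with
    | empty => simp [hx]
    | insert j F hj ih =>
      refine ih.trans ?_
      rw [Finset.sum_insert hj, ← add_assoc]
      gcongr
      by_cases hjj : ω j = ω₂ j
      · have : x (insert j F) = x F := by
          ext k
          by_cases hk : k = j
          · subst hk; simp [hx, hj, hjj]
          · simp [hx, hk]
        simp [this]
      · simp only [hjj, if_false]
        refine siteMarginal_le_of_eq_off hT hΦ hpos i j (hxT _) (hxT _) (fun k hk => ?_) hB
        simp [hx, hk]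
  have hf : Measurable ((fun σ : G → S => σ i) ⁻¹' B |>.indicator (1 : (G → S) → ℝ≥0∞)) :=
    measurable_one.indicator (measurable_pi_apply i hB)
  have heq (ω : G → S) : siteMarginal Φ lam T ω' i ω B =
      ∫⁻ ξ, ((fun σ : G → S => σ i) ⁻¹' B).indicator 1 ξ ∂constrainedSpec Φ lam T ω' {i} ω := by
    rw [siteMarginal, Measure.map_apply (measurable_pi_apply i) hB,
      lintegral_indicator_one (measurable_pi_apply i hB)]
  have hlim : Filter.Tendsto (fun F => siteMarginal Φ lam T ω' i (x F) B) Filter.atTop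
      (nhds (siteMarginal Φ lam T ω' i ω₂ B)) := by
    simp_rw [heq]
    refine tendsto_lintegral_constrainedSpec hT hΦ hpos ω' {i} (fun j => ?_) hf
      (fun ω => Set.indicator_le_self' (fun _ _ => zero_le) ω) (fun y => ?_)
    · filter_upwards [Filter.eventually_ge_atTop ({j} : Finset G)] with F hF
      have : j ∈ F := hF (by simp)
      simp [hx, this]
    · refine tendsto_const_nhds.congr fun F => ?_
      simp [Set.indicator, Function.updateFinset]
  refine ge_of_tendsto' (hlim.add_const _) fun F => (hfin F).trans ?_
  gcongr
  exact ENNReal.sum_le_tsum F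

include hT hΦ hpos in
open scoped Classical in
/-- The effect of a single-site average on the oscillations. -/
lemma HammingBound.average {ω' : G → Fin q} {f : (G → S) → ℝ≥0∞} {a : G → ℝ≥0∞}
    (h : HammingBound T ω' f a) (hf : Measurable f) (hf1 : ∀ ω, f ω ≤ 1) (i : G) :
    HammingBound T ω' (fun ω => ∫⁻ ξ, f ξ ∂constrainedSpec Φ lam T ω' {i} ω)
      (dust (dobrushinMatrix Φ lam T) i a) := by
  intro ω ω₂ hω hω₂
  -- The kernel at `i` ignores the boundary spin at `i`, so one may assume that the two
  -- configurations agree there; this is why the new weight at `i` is zero.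
  set ω₃ : G → S := Function.update ω₂ i (ω i) with hω₃
  have hω₃T (k : G) : T (ω₃ k) = ω' k := by
    by_cases hk : k = i
    · subst hk; simpa [hω₃] using hω k
    · simpa [hω₃, hk] using hω₂ k
  have hupd {x : G → S} (hx : ∀ k, T (x k) = ω' k) {s : S} (hs : s ∈ T ⁻¹' {ω' i}) (k : G) :
      T (Function.update x i s k) = ω' k := by
    by_cases hk : k = i
    · subst hk; simpa using hs
    · simpa [hk] using hx k
  have h1 := isProbabilityMeasure_siteMarginal hT hΦ hpos ω' i ω
  have h3 := isProbabilityMeasure_siteMarginal hT hΦ hpos ω' i ω₃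
  have hcongr : ∫⁻ ξ, f ξ ∂constrainedSpec Φ lam T ω' {i} ω₂ =
      ∫⁻ ξ, f ξ ∂constrainedSpec Φ lam T ω' {i} ω₃ :=
    lintegral_constrainedSpec_congr hT hΦ hpos ω' {i} (fun k hk => by
      have : k ≠ i := by simpa using hk
      simp [hω₃, this]) hf
  simp only [hcongr]
  rw [lintegral_constrainedSpec_singleton hT hΦ hpos ω' i ω hf,
    lintegral_constrainedSpec_singleton hT hΦ hpos ω' i ω₃ hf]
  set D : ℝ≥0∞ := ∑' j, if ω j = ω₃ j then 0 else a j
  set t : ℝ≥0∞ := ∑' j, if ω j = ω₃ j then 0 else dobrushinMatrix Φ lam T i j with ht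
  -- First the integrand changes under a fixed single-site law, then (`hstep2`) the law changes
  -- under a fixed integrand whose oscillation in the spin at `i` is at most `a i`.
  have hstep1 : ∫⁻ s, f (Function.update ω i s) ∂siteMarginal Φ lam T ω' i ω ≤
      ∫⁻ s, f (Function.update ω₃ i s) ∂siteMarginal Φ lam T ω' i ω + D := by
    calc _ ≤ ∫⁻ s, (f (Function.update ω₃ i s) + D) ∂siteMarginal Φ lam T ω' i ω := by
          refine lintegral_mono_ae ((ae_siteMarginal hT hΦ hpos i hω).mono fun s hs => ?_)
          refine (h _ _ (hupd hω hs) (hupd hω₃T hs)).trans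
            (add_le_add le_rfl (ENNReal.tsum_le_tsum fun j => ?_))
          by_cases hj : j = i
          · subst hj; simp
          · simp [hj]
      _ = _ := by rw [lintegral_add_right _ measurable_const]; simp
  have hstep2 : ∫⁻ s, f (Function.update ω₃ i s) ∂siteMarginal Φ lam T ω' i ω ≤
      ∫⁻ s, f (Function.update ω₃ i s) ∂siteMarginal Φ lam T ω' i ω₃ + a i * t := by
    refine lintegral_le_lintegral_add_osc
      (fun B hB => siteMarginal_le_add_tsum hT hΦ hpos i hω hω₃T hB)
      (hf.comp (measurable_update ω₃)) (fun s => hf1 _) (hT (measurableSet_singleton (ω' i)))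
      (ae_siteMarginal hT hΦ hpos i hω) (ae_siteMarginal hT hΦ hpos i hω₃T) fun s hs s₂ hs₂ => ?_
    refine (h _ _ (hupd hω₃T hs) (hupd hω₃T hs₂)).trans (add_le_add le_rfl ?_)
    rw [tsum_eq_single i fun j hj => by simp [hj]]
    split_ifs <;> simp
  refine (hstep1.trans (add_le_add_left hstep2 D)).trans ?_
  rw [add_assoc]
  gcongr
  rw [ht, ← ENNReal.tsum_mul_left, ← ENNReal.tsum_add]
  refine ENNReal.tsum_le_tsum fun j => ?_
  by_cases hj : j = i
  · subst hj; simp [hω₃]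
  · by_cases hjj : ω j = ω₂ j
    · simp [hω₃, hj, hjj]
    · simp [hω₃, hj, hjj, dust, add_comm, mul_comm]

variable (Φ lam T) in
/-- Successive single-site averages along a list of sites; the head of the list acts last. -/
noncomputable def averageList (ω' : G → Fin q) (l : List G) (f : (G → S) → ℝ≥0∞) :
    (G → S) → ℝ≥0∞ :=
  l.foldr (fun i g ω => ∫⁻ ξ, g ξ ∂constrainedSpec Φ lam T ω' {i} ω) f

include hT hΦ hpos in
lemma measurable_averageList (ω' : G → Fin q) (l : List G) {f : (G → S) → ℝ≥0∞}
    (hf : Measurable f) : Measurable (averageList Φ lam T ω' l f) := by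
  induction l with
  | nil => exact hf
  | cons i l ih => exact measurable_lintegral_constrainedSpec hT hΦ hpos ω' {i} ih

include hT hΦ hpos in
lemma averageList_le_one (ω' : G → Fin q) (l : List G) {f : (G → S) → ℝ≥0∞}
    (hf1 : ∀ ω, f ω ≤ 1) (ω : G → S) : averageList Φ lam T ω' l f ω ≤ 1 := by
  induction l generalizing ω with
  | nil => exact hf1 ω
  | cons i l ih =>
    have := isProbabilityMeasure_constrainedSpec hT hΦ hpos ω' {i} ω
    calc ∫⁻ ξ, averageList Φ lam T ω' l f ξ ∂constrainedSpec Φ lam T ω' {i} ω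
        ≤ ∫⁻ ξ, 1 ∂constrainedSpec Φ lam T ω' {i} ω := lintegral_mono fun ξ => ih ξ
      _ = 1 := by simp

include hT hΦ hpos in
lemma HammingBound.averageList {ω' : G → Fin q} {f : (G → S) → ℝ≥0∞} {a : G → ℝ≥0∞}
    (h : HammingBound T ω' f a) (hf : Measurable f) (hf1 : ∀ ω, f ω ≤ 1) (l : List G) :
    HammingBound T ω' (averageList Φ lam T ω' l f) (dustList (dobrushinMatrix Φ lam T) l a) := by
  induction l with
  | nil => exact h
  | cons i l ih =>
    exact HammingBound.average hT hΦ hpos ih (measurable_averageList hT hΦ hpos ω' l hf)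
      (averageList_le_one hT hΦ hpos ω' l hf1) i

-- By consistency, averaging over sites inside `Λ` is invisible to the specification in `Λ`.
include hT hΦ hpos in
lemma lintegral_averageList_constrainedSpec (ω' : G → Fin q) {l : List G} {Λ : Finset G}
    (hl : ∀ i ∈ l, i ∈ Λ) {f : (G → S) → ℝ≥0∞} (hf : Measurable f) (η : G → S) :
    ∫⁻ ω, averageList Φ lam T ω' l f ω ∂constrainedSpec Φ lam T ω' Λ η =
      ∫⁻ ω, f ω ∂constrainedSpec Φ lam T ω' Λ η := by
  induction l with
  | nil => rfl
  | cons i l ih =>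
    rw [← ih fun j hj => hl j (List.mem_cons_of_mem i hj)]
    exact lintegral_constrainedSpec_lintegral hT hΦ hpos ω'
      (Finset.singleton_subset_iff.2 (hl i List.mem_cons_self))
      (measurable_averageList hT hΦ hpos ω' l hf) η

omit [Countable G] in
lemma tsum_dobrushinMatrix_le (Φ : Potential G S) (lam : Measure S) (T : S → Fin q) (i : G) :
    ∑' j, dobrushinMatrix Φ lam T i j ≤ dobrushinConstant Φ lam T :=
  le_iSup (fun i => ∑' j, dobrushinMatrix Φ lam T i j) i

variable (hDob : dobrushinConstant Φ lam T < 1)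

include hT hΦ hpos hDob in
/-- Under the uniform Dobrushin condition the finite-volume expectations become independent of the
volume and of the boundary condition, uniformly over all functions with given oscillations. -/
lemma exists_finset_lintegral_le (ω' : G → Fin q) {a : G → ℝ≥0∞} (ha : ∑' j, a j ≠ ∞)
    {ε : ℝ≥0∞} (hε : 0 < ε) :
    ∃ Λ₀ : Finset G, ∀ Λ Λ₂ : Finset G, Λ₀ ⊆ Λ → Λ₀ ⊆ Λ₂ → ∀ f : (G → S) → ℝ≥0∞, Measurable f →
      (∀ ω, f ω ≤ 1) → HammingBound T ω' f a → ∀ ω ω₂ : G → S,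
      (∀ i, T (ω i) = ω' i) → (∀ i, T (ω₂ i) = ω' i) →
      ∫⁻ ξ, f ξ ∂constrainedSpec Φ lam T ω' Λ ω ≤
        ∫⁻ ξ, f ξ ∂constrainedSpec Φ lam T ω' Λ₂ ω₂ + ε := by
  classical
  obtain ⟨l, hl⟩ := exists_dustList_tsum_lt (tsum_dobrushinMatrix_le Φ lam T) hDob ha hε
  refine ⟨l.toFinset, fun Λ Λ₂ hΛ hΛ₂ f hf hf1 hfa ω ω₂ hω hω₂ => ?_⟩
  have h1 := isProbabilityMeasure_constrainedSpec hT hΦ hpos ω' Λ ω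
  have h2 := isProbabilityMeasure_constrainedSpec hT hΦ hpos ω' Λ₂ ω₂
  have hg := measurable_averageList (Φ := Φ) (lam := lam) hT hΦ hpos ω' l hf
  rw [← lintegral_averageList_constrainedSpec hT hΦ hpos ω'
      (fun i hi => hΛ (List.mem_toFinset.2 hi)) hf ω,
    ← lintegral_averageList_constrainedSpec hT hΦ hpos ω'
      (fun i hi => hΛ₂ (List.mem_toFinset.2 hi)) hf ω₂]
  have hosc {ξ ξ₂ : G → S} (hξ : ∀ i, T (ξ i) = ω' i) (hξ₂ : ∀ i, T (ξ₂ i) = ω' i) :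
      averageList Φ lam T ω' l f ξ ≤ averageList Φ lam T ω' l f ξ₂ + ε :=
    ((hfa.averageList hT hΦ hpos hf hf1 l).le_add_tsum hξ hξ₂).trans (by gcongr)
  set K : ℝ≥0∞ := ∫⁻ ξ, averageList Φ lam T ω' l f ξ ∂constrainedSpec Φ lam T ω' Λ ω
  have hK {ξ₂ : G → S} (hξ₂ : ∀ i, T (ξ₂ i) = ω' i) : K ≤ averageList Φ lam T ω' l f ξ₂ + ε := by
    calc K ≤ ∫⁻ ξ, (averageList Φ lam T ω' l f ξ₂ + ε) ∂constrainedSpec Φ lam T ω' Λ ω :=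
          lintegral_mono_ae ((ae_constrainedSpec hT hΦ hpos hω).mono fun ξ hξ => hosc hξ hξ₂)
      _ = _ := by simp
  calc K = ∫⁻ ξ, K ∂constrainedSpec Φ lam T ω' Λ₂ ω₂ := by simp
    _ ≤ ∫⁻ ξ, (averageList Φ lam T ω' l f ξ + ε) ∂constrainedSpec Φ lam T ω' Λ₂ ω₂ :=
        lintegral_mono_ae ((ae_constrainedSpec hT hΦ hpos hω₂).mono fun ξ hξ => hK hξ)
    _ = _ := by rw [lintegral_add_right _ measurable_const]; simp

end Dobrushin

/-! ### Existence of constrained Gibbs measures. -/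

section Existence

lemma dependsOn_indicator_cylinder {G S : Type*} (D : Finset G) (B : Set (D → S)) :
    DependsOn ((cylinder (α := fun _ : G => S) D B).indicator (1 : (G → S) → ℝ≥0∞))
      (D : Set G) := by
  intro ω ω₂ h
  have : D.restrict (π := fun _ => S) ω = D.restrict ω₂ := funext fun i => h i i.2
  have hiff : ω ∈ cylinder D B ↔ ω₂ ∈ cylinder D B := by
    rw [mem_cylinder, mem_cylinder, this]
  by_cases hm : ω ∈ cylinder D B
  · rw [Set.indicator_of_mem hm, Set.indicator_of_mem (hiff.1 hm), Pi.one_apply, Pi.one_apply]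
  · rw [Set.indicator_of_notMem hm, Set.indicator_of_notMem (mt hiff.2 hm)]

lemma indicator_one_le_one {X : Type*} (B : Set X) (x : X) :
    B.indicator (1 : X → ℝ≥0∞) x ≤ 1 :=
  Set.indicator_le_self' (fun _ _ => zero_le) x

open scoped Classical in
lemma tsum_indicator_finset_ne_top {G : Type*} (D : Finset G) :
    ∑' j, (if j ∈ D then (1 : ℝ≥0∞) else 0) ≠ ∞ := by
  rw [tsum_eq_sum (s := D) fun j hj => by simp [hj]]
  exact ENNReal.sum_ne_top.2 fun j hj => by simp [hj]

variable {G S : Type*} [Countable G] [MeasurableSpace S] {Φ : Potential G S}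
  {lam : Measure S} [IsFiniteMeasure lam] {q : ℕ} {T : S → Fin q} (hT : Measurable T)
  (hΦ : AbsolutelySummable Φ) (hpos : ∀ k : Fin q, 0 < lam (T ⁻¹' {k}))

include hpos in
omit [IsFiniteMeasure lam] in
lemma exists_section : ∃ s : Fin q → S, ∀ k, T (s k) = k := by
  have h (k : Fin q) : ∃ s, T s = k := nonempty_of_measure_ne_zero (hpos k).ne'
  exact ⟨fun k => (h k).choose, fun k => (h k).choose_spec⟩

include hT hΦ hpos in
lemma measurable_constrainedSpec (ω' : G → Fin q) (Λ : Finset G) :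
    Measurable (constrainedSpec Φ lam T ω' Λ) := by
  refine Measure.measurable_of_measurable_coe _ fun B hB => ?_
  simp_rw [← lintegral_indicator_one hB]
  exact measurable_lintegral_constrainedSpec hT hΦ hpos ω' Λ (measurable_one.indicator hB)

include hT in
omit [Countable G] in
lemma measurableSet_color (ω' : G → Fin q) (i : G) :
    MeasurableSet {ω : G → S | T (ω i) = ω' i} :=
  (hT.comp (measurable_pi_apply i)) (measurableSet_singleton (ω' i))

variable (hDob : dobrushinConstant Φ lam T < 1)

include hT hΦ hpos in
/-- The single-site kernels have uniformly bounded densities. -/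
lemma exists_constrainedSpec_singleton_le (ω' : G → Fin q) (i : G) :
    ∃ K : ℝ≥0∞, K ≠ ∞ ∧ ∀ (f : (G → S) → ℝ≥0∞), Measurable f → ∀ ω : G → S,
      ∫⁻ ξ, f ξ ∂constrainedSpec Φ lam T ω' {i} ω ≤
        K * ∫⁻ s, f (open Classical in Function.update ω i s) ∂lam := by
  classical
  set m : ℝ≥0∞ := ENNReal.ofReal (Real.exp (-energyBound Φ {i})) *
    ∏ j : ({i} : Finset G), lam (T ⁻¹' {ω' j}) with hm
  have hm0 : m ≠ 0 := mul_ne_zero (by simp [Real.exp_pos])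
    (Finset.prod_ne_zero_iff.2 fun j _ => (hpos _).ne')
  refine ⟨m⁻¹ * ENNReal.ofReal (Real.exp (energyBound Φ {i})),
    ENNReal.mul_ne_top (ENNReal.inv_ne_top.2 hm0) ENNReal.ofReal_ne_top, fun f hf ω => ?_⟩
  have hfu : Measurable fun s => f (Function.update ω i s) := hf.comp (measurable_update ω)
  rw [lintegral_constrainedSpec hT hΦ hpos ω' {i} ω hf, mul_assoc]
  refine mul_le_mul' (ENNReal.inv_le_inv.2 (le_partitionFunction hΦ ω' {i} ω)) ?_
  rw [lmarginal_singleton, ← lintegral_const_mul _ hfu]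
  refine (lintegral_mono fun s => mul_le_mul' (boltzmann_le hΦ {i} _) le_rfl).trans ?_
  refine (lintegral_mono' Measure.restrict_le_self le_rfl).trans (le_of_eq ?_)
  congr! with s

include hT hΦ hpos hDob in
/-- The finite-volume Gibbs measures converge, in total variation on every finite set of sites,
to a probability measure. -/
lemma exists_limit_measure {ω' : G → Fin q} {η : G → S} (hη : ∀ i, T (η i) = ω' i) :
    ∃ μ : Measure (G → S), IsProbabilityMeasure μ ∧ ∀ (D : Finset G) (ε : ℝ≥0∞), 0 < ε →
      ∀ᶠ Λ in Filter.atTop, ∀ B : Set (D → S), MeasurableSet B →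
        (constrainedSpec Φ lam T ω' Λ η).map D.restrict B ≤ μ.map D.restrict B + ε ∧
        μ.map D.restrict B ≤ (constrainedSpec Φ lam T ω' Λ η).map D.restrict B + ε := by
  classical
  have hres (D : Finset G) : Measurable (D.restrict (π := fun _ => S)) :=
    Finset.measurable_restrict (X := fun _ => S) D
  set ν : Finset G → Measure (G → S) := fun Λ => constrainedSpec Φ lam T ω' Λ η with hν
  have hνp (Λ : Finset G) : IsProbabilityMeasure (ν Λ) :=
    isProbabilityMeasure_constrainedSpec hT hΦ hpos ω' Λ η
  have hνDp (D Λ : Finset G) : IsProbabilityMeasure ((ν Λ).map (D.restrict (π := fun _ => S))) :=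
    Measure.isProbabilityMeasure_map (hres D).aemeasurable
  have hcyl (D Λ : Finset G) (B : Set (D → S)) (hB : MeasurableSet B) :
      (ν Λ).map (D.restrict (π := fun _ => S)) B =
        ∫⁻ ξ, (cylinder (α := fun _ => S) D B).indicator 1 ξ ∂ν Λ := by
    rw [lintegral_indicator_one (hB.cylinder D), Measure.map_apply (hres D) hB]
    rfl
  have hlim (D : Finset G) : ∃ P : Measure (D → S), IsProbabilityMeasure P ∧ ∀ ε : ℝ≥0∞, 0 < ε →
      ∀ᶠ Λ in Filter.atTop, ∀ B, MeasurableSet B →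
        (ν Λ).map (D.restrict (π := fun _ => S)) B ≤ P B + ε ∧
        P B ≤ (ν Λ).map (D.restrict (π := fun _ => S)) B + ε := by
    -- All cylinder indicators over `D` share the weights `1` on `D`, so the volume estimate is
    -- uniform in the event.
    refine exists_tv_limit (hνDp D) fun ε hε => ?_
    obtain ⟨Λ₀, hΛ₀⟩ := exists_finset_lintegral_le hT hΦ hpos hDob ω'
      (tsum_indicator_finset_ne_top D) hε
    filter_upwards [Filter.eventually_ge_atTop Λ₀] with Λ hΛ
    filter_upwards [Filter.eventually_ge_atTop Λ₀] with Λ₂ hΛ₂ B hB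
    have hBm : Measurable ((cylinder (α := fun _ => S) D B).indicator (1 : (G → S) → ℝ≥0∞)) :=
      measurable_one.indicator (hB.cylinder D)
    have hH := hammingBound_of_dependsOn T ω' (dependsOn_indicator_cylinder D B)
      (indicator_one_le_one _)
    rw [hcyl D Λ B hB, hcyl D Λ₂ B hB]
    exact ⟨hΛ₀ Λ Λ₂ hΛ hΛ₂ _ hBm (indicator_one_le_one _) hH η η hη hη,
      hΛ₀ Λ₂ Λ hΛ₂ hΛ _ hBm (indicator_one_le_one _) hH η η hη hη⟩
  choose P hPp hP using hlim
  have htend (D : Finset G) (B : Set (D → S)) (hB : MeasurableSet B) :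
      Filter.Tendsto (fun Λ => (ν Λ).map (D.restrict (π := fun _ => S)) B) Filter.atTop
        (nhds (P D B)) := by
    rw [ENNReal.tendsto_nhds (measure_ne_top _ _)]
    intro ε hε
    filter_upwards [hP D ε hε] with Λ hΛ
    exact ⟨tsub_le_iff_right.2 (hΛ B hB).2, (hΛ B hB).1⟩
  have hproj : IsProjectiveMeasureFamily (α := fun _ : G => S) P := by
    intro I J hJI
    have h2 : Measurable (Finset.restrict₂ (π := fun _ : G => S) hJI) :=
      Finset.measurable_restrict₂ (X := fun _ => S) hJI
    ext B hB
    rw [Measure.map_apply h2 hB]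
    refine tendsto_nhds_unique (htend J B hB) ((htend I _ (h2 hB)).congr fun Λ => ?_)
    rw [← Measure.map_apply h2 hB, Measure.map_map h2 (hres I)]
    rfl
  obtain ⟨μ, hμ, hμP⟩ := exists_isProjectiveLimit P hPp hproj (fun _ => lam)
    (fun _ => inferInstance) (fun D D' h i hi hiD => by
      set r : (D' → S) → (D → S) × S :=
        fun x => (Finset.restrict₂ (π := fun _ => S) h x, x ⟨i, hi⟩) with hr
      have hrm : Measurable r := (Finset.measurable_restrict₂ (X := fun _ => S) h).prodMk
        (measurable_pi_apply (X := fun _ => S) _)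
      obtain ⟨K, hK, hKle⟩ := exists_constrainedSpec_singleton_le hT hΦ hpos ω' i
      refine Measure.AbsolutelyContinuous.mk fun B hB hB0 => ?_
      rw [Measure.map_apply hrm hB]
      set u : (D → S) → ℝ≥0∞ := fun x => lam (Prod.mk x ⁻¹' B) with hu
      have hum : Measurable u := measurable_measure_prodMk_left hB
      have hu0 : ∫⁻ x, u x ∂P D = 0 := by rw [← Measure.prod_apply hB]; exact hB0
      set A : Set (G → S) := {ξ | (D.restrict (π := fun _ => S) ξ, ξ i) ∈ B} with hA
      have hAm : MeasurableSet A :=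
        ((hres D).prodMk (measurable_pi_apply i)) hB
      -- Resample the spin at `i`: the spins in `D` are untouched, and the new spin has density at
      -- most `K`, so the section of `B` is hit with probability at most `K` times its `lam`-mass.
      have hbound (Λ : Finset G) (hΛ : i ∈ Λ) : ν Λ A ≤
          K * ∫⁻ x, u x ∂(ν Λ).map (D.restrict (π := fun _ => S)) := by
        rw [lintegral_map hum (hres D), ← lintegral_indicator_one hAm,
          ← lintegral_constrainedSpec_lintegral hT hΦ hpos ω' (Finset.singleton_subset_iff.2 hΛ)
            (measurable_one.indicator hAm)]
        refine le_trans ?_ (lintegral_const_mul K (hum.comp (hres D))).le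
        refine lintegral_mono fun ω => (hKle _ (measurable_one.indicator hAm) ω).trans ?_
        gcongr
        have hset : MeasurableSet (Prod.mk (D.restrict (π := fun _ => S) ω) ⁻¹' B) :=
          measurable_prodMk_left hB
        change _ ≤ lam (Prod.mk (D.restrict (π := fun _ => S) ω) ⁻¹' B)
        rw [← lintegral_indicator_one hset]
        refine lintegral_mono fun s => le_of_eq ?_
        have : D.restrict (π := fun _ => S) (Function.update ω i s) = D.restrict ω := by
          ext j
          have : (j : G) ≠ i := fun hj => hiD (hj ▸ j.2)
          simp [this]
        have h2 : Function.update ω i s ∈ A ↔ s ∈ Prod.mk (D.restrict (π := fun _ => S) ω) ⁻¹' B := by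
          simp [hA, this]
        simp only [Set.indicator, h2]
        rfl
      refine le_zero_iff.1 (ENNReal.le_of_forall_pos_le_add fun ε hε _ => ?_)
      -- Passing to the limit costs `K * lam univ * δ` on the integral over `D` and `δ` on the event
      -- over `D'`.
      set δ : ℝ≥0∞ := ε / (K * lam Set.univ + 1) with hδ
      have hKl : K * lam Set.univ + 1 ≠ ∞ :=
        ENNReal.add_ne_top.2 ⟨ENNReal.mul_ne_top hK (measure_ne_top _ _), ENNReal.one_ne_top⟩
      have hδ0 : 0 < δ := ENNReal.div_pos (by simpa using hε.ne') hKl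
      obtain ⟨Λ, hΛ1, hΛ2, hΛi⟩ := ((hP D δ hδ0).and ((hP D' δ hδ0).and
        (Filter.eventually_ge_atTop ({i} : Finset G)))).exists
      have h1 := lintegral_le_lintegral_add_of_le (fun B hB => (hΛ1 B hB).1) hum
        (measure_ne_top lam Set.univ) (fun x => measure_mono (Set.subset_univ _))
      have h3 : (ν Λ).map (D'.restrict (π := fun _ => S)) (r ⁻¹' B) = ν Λ A := by
        rw [Measure.map_apply (hres D') (hrm hB)]
        rfl
      calc P D' (r ⁻¹' B) ≤ ν Λ A + δ := h3 ▸ (hΛ2 _ (hrm hB)).2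
        _ ≤ K * (0 + lam Set.univ * δ) + δ := by
            gcongr
            exact (hbound Λ (Finset.singleton_subset_iff.1 hΛi)).trans (by rw [hu0] at h1; gcongr)
        _ = (K * lam Set.univ + 1) * δ := by ring
        _ ≤ 0 + ε := by
            rw [zero_add, hδ]
            exact ENNReal.mul_div_le)
  refine ⟨μ, hμ, fun D ε hε => ?_⟩
  rw [hμP D]
  exact hP D ε hε

include hT hΦ hpos hDob in
/-- Existence of a constrained Gibbs measure. -/
lemma exists_isConstrainedGibbs (ω' : G → Fin q) :
    ∃ μ : Measure (G → S), IsConstrainedGibbs Φ lam T ω' μ := by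
  classical
  obtain ⟨s, hs⟩ := exists_section (T := T) hpos
  set η : G → S := fun i => s (ω' i)
  have hη (i : G) : T (η i) = ω' i := hs _
  obtain ⟨μ, hμ, hlim⟩ := exists_limit_measure hT hΦ hpos hDob hη
  set ν : Finset G → Measure (G → S) := fun Λ => constrainedSpec Φ lam T ω' Λ η with hν
  have hνp (Λ : Finset G) : IsProbabilityMeasure (ν Λ) :=
    isProbabilityMeasure_constrainedSpec hT hΦ hpos ω' Λ η
  have hνae (Λ : Finset G) : ∀ᵐ ω ∂ν Λ, ∀ i, T (ω i) = ω' i := ae_constrainedSpec hT hΦ hpos hη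
  have hres (D : Finset G) : Measurable (D.restrict (π := fun _ => S)) :=
    Finset.measurable_restrict (X := fun _ => S) D
  have hlocal (D : Finset G) (ε : ℝ≥0∞) (hε : 0 < ε) : ∀ᶠ Λ in Filter.atTop,
      ∀ f : (G → S) → ℝ≥0∞, Measurable f → (∀ ω, f ω ≤ 1) → DependsOn f (D : Set G) →
        ∫⁻ ω, f ω ∂ν Λ ≤ ∫⁻ ω, f ω ∂μ + ε ∧ ∫⁻ ω, f ω ∂μ ≤ ∫⁻ ω, f ω ∂ν Λ + ε := by
    filter_upwards [hlim D ε hε] with Λ hΛ f hf hf1 hfD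
    have hg : Measurable fun x : D → S => f (Function.updateFinset η D x) :=
      hf.comp measurable_updateFinset
    have heq (ρ : Measure (G → S)) : ∫⁻ ω, f ω ∂ρ =
        ∫⁻ x, f (Function.updateFinset η D x) ∂ρ.map (D.restrict (π := fun _ => S)) := by
      rw [lintegral_map hg (hres D)]
      refine lintegral_congr fun ω => hfD fun j hj => ?_
      have : j ∈ D := hj
      simp [Function.updateFinset, this]
    rw [heq, heq]
    have h1 := lintegral_le_lintegral_add_of_le (fun B hB => (hΛ B hB).1) hg
      ENNReal.one_ne_top fun x => hf1 _
    have h2 := lintegral_le_lintegral_add_of_le (fun B hB => (hΛ B hB).2) hg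
      ENNReal.one_ne_top fun x => hf1 _
    rw [one_mul] at h1 h2
    exact ⟨h1, h2⟩
  have hμae : ∀ᵐ ω ∂μ, ∀ i, T (ω i) = ω' i := by
    refine ae_all_iff.2 fun i => ?_
    have hm := (measurableSet_color hT ω' i).compl
    rw [ae_iff]
    change μ {ω : G → S | T (ω i) = ω' i}ᶜ = 0
    refine le_zero_iff.1 (ENNReal.le_of_forall_pos_le_add fun ε hε _ => ?_)
    obtain ⟨Λ, hΛ⟩ := (hlocal {i} ε (by exact_mod_cast hε)).exists
    have h1 := (hΛ ({ω : G → S | T (ω i) = ω' i}ᶜ.indicator 1) (measurable_one.indicator hm)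
      (indicator_one_le_one _) (fun ω ω₂ h => by
        have : ω i = ω₂ i := h i (by simp)
        simp [Set.indicator, this])).2
    rw [lintegral_indicator_one hm, lintegral_indicator_one hm] at h1
    have h0 : ν Λ {ω : G → S | T (ω i) = ω' i}ᶜ = 0 := (hνae Λ).mono fun ω hω => hω i
    rwa [h0] at h1
  -- Convergence extends from local functions to those with summable weights: freezing the spins
  -- outside a large `F` to `η` changes `g` by at most the weight outside `F`.
  have hquasi (b : G → ℝ≥0∞) (hb : ∑' j, b j ≠ ∞) (g : (G → S) → ℝ≥0∞) (hg : Measurable g)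
      (hg1 : ∀ ω, g ω ≤ 1) (hgb : HammingBound T ω' g b) (ε : ℝ≥0∞) (hε : 0 < ε) :
      ∀ᶠ Λ in Filter.atTop, ∫⁻ ω, g ω ∂ν Λ ≤ ∫⁻ ω, g ω ∂μ + ε ∧
        ∫⁻ ω, g ω ∂μ ≤ ∫⁻ ω, g ω ∂ν Λ + ε := by
    have hε3 : 0 < ε / 3 := ENNReal.div_pos hε.ne' (by simp)
    obtain ⟨F, hF⟩ :=
      ((ENNReal.tendsto_tsum_compl_atTop_zero hb).eventually_lt_const hε3).exists
    set gF : (G → S) → ℝ≥0∞ := fun ω => g (Function.updateFinset η F (F.restrict ω))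
    have hgF : Measurable gF := hg.comp (measurable_updateFinset.comp (hres F))
    have hclose {ω ω₂ : G → S} (hω : ∀ i, T (ω i) = ω' i) (hω₂ : ∀ i, T (ω₂ i) = ω' i)
        (h : ∀ j ∈ F, ω j = ω₂ j) : g ω ≤ g ω₂ + ε / 3 := by
      refine (hgb ω ω₂ hω hω₂).trans (add_le_add le_rfl (le_trans ?_ hF.le))
      refine le_trans ?_ (tsum_subtype {j | j ∉ F} b).ge
      refine ENNReal.tsum_le_tsum fun j => ?_
      by_cases hj : j ∈ F
      · simp [h j hj]
      · rw [Set.indicator_of_mem (by exact hj)]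
        split_ifs <;> simp
    have hFT {ω : G → S} (hω : ∀ i, T (ω i) = ω' i) (i : G) :
        T (Function.updateFinset η F (F.restrict ω) i) = ω' i := by
      by_cases hi : i ∈ F <;> simp [Function.updateFinset, hi, hω, hη]
    have hFeq (ω : G → S) (j : G) (hj : j ∈ F) :
        Function.updateFinset η F (F.restrict ω) j = ω j := by
      simp [Function.updateFinset, hj]
    have hint (ρ : Measure (G → S)) [IsProbabilityMeasure ρ]
        (hρ : ∀ᵐ ω ∂ρ, ∀ i, T (ω i) = ω' i) :
        ∫⁻ ω, g ω ∂ρ ≤ ∫⁻ ω, gF ω ∂ρ + ε / 3 ∧ ∫⁻ ω, gF ω ∂ρ ≤ ∫⁻ ω, g ω ∂ρ + ε / 3 := by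
      have hc (u : (G → S) → ℝ≥0∞) : ∫⁻ ω, u ω ∂ρ + ε / 3 = ∫⁻ ω, (u ω + ε / 3) ∂ρ := by
        rw [lintegral_add_right _ measurable_const]; simp
      rw [hc, hc]
      exact ⟨lintegral_mono_ae (hρ.mono fun ω hω => hclose hω (hFT hω) fun j hj =>
        (hFeq ω j hj).symm), lintegral_mono_ae (hρ.mono fun ω hω => hclose (hFT hω) hω (hFeq ω))⟩
    filter_upwards [hlocal F (ε / 3) hε3] with Λ hΛ
    have hd := hΛ gF hgF (fun ω => hg1 _) (fun ω ω₂ h => by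
      have : F.restrict (π := fun _ => S) ω = F.restrict ω₂ := funext fun i => h i i.2
      simp only [gF, this])
    have hμ2 := hint μ hμae
    have hν2 := hint (ν Λ) (hνae Λ)
    have e3 (x : ℝ≥0∞) : x + ε / 3 + ε / 3 + ε / 3 = x + ε := by
      rw [add_assoc, add_assoc, ← add_assoc (ε / 3), ENNReal.add_thirds]
    constructor
    · calc _ ≤ _ := hν2.1
        _ ≤ (∫⁻ ω, gF ω ∂μ + ε / 3) + ε / 3 := by gcongr; exact hd.1
        _ ≤ ((∫⁻ ω, g ω ∂μ + ε / 3) + ε / 3) + ε / 3 := by gcongr; exact hμ2.2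
        _ = _ := e3 _
    · calc _ ≤ _ := hμ2.1
        _ ≤ (∫⁻ ω, gF ω ∂ν Λ + ε / 3) + ε / 3 := by gcongr; exact hd.2
        _ ≤ ((∫⁻ ω, g ω ∂ν Λ + ε / 3) + ε / 3) + ε / 3 := by gcongr; exact hν2.2
        _ = _ := e3 _
  refine ⟨μ, hμ, hμae, fun Δ B hB => ?_⟩
  have hspecm := measurable_constrainedSpec (Φ := Φ) (lam := lam) hT hΦ hpos ω' Δ
  rw [← Measure.bind_apply hB hspecm.aemeasurable]
  congr 1
  have hbp : IsProbabilityMeasure (μ.bind (constrainedSpec Φ lam T ω' Δ)) := by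
    refine ⟨?_⟩
    rw [Measure.bind_apply .univ hspecm.aemeasurable]
    have h1 (ω : G → S) : constrainedSpec Φ lam T ω' Δ ω Set.univ = 1 :=
      (isProbabilityMeasure_constrainedSpec hT hΦ hpos ω' Δ ω).measure_univ
    simp [h1]
  refine ext_of_generate_finite (measurableCylinders fun _ : G => S)
    generateFrom_measurableCylinders.symm isPiSystem_measurableCylinders (fun C hC => ?_)
    (by rw [hbp.measure_univ, hμ.measure_univ])
  obtain ⟨D, C, hCm, rfl⟩ := (mem_measurableCylinders _).1 hC
  set f : (G → S) → ℝ≥0∞ := (cylinder (α := fun _ => S) D C).indicator 1 with hf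
  have hcm : MeasurableSet (cylinder (α := fun _ : G => S) D C) := hCm.cylinder D
  have hfm : Measurable f := measurable_one.indicator hcm
  have hf1 : ∀ ω, f ω ≤ 1 := indicator_one_le_one _
  have hfH := hammingBound_of_dependsOn T ω' (dependsOn_indicator_cylinder (S := S) D C) hf1
  rw [← lintegral_indicator_one hcm, ← lintegral_indicator_one hcm,
    Measure.lintegral_bind hspecm.aemeasurable hfm.aemeasurable]
  -- The expectation of `f` in `Δ` is replaced by an iterated average `g` that nearly ignores the
  -- spins in `Δ` and has summable weights. Then `μ` and `ν Λ` nearly agree on both `g` and `f`,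
  -- while `ν Λ` gives them the same integral.
  have key (ε : ℝ≥0∞) (hε : 0 < ε) :
      ∫⁻ ω, ∫⁻ ξ, f ξ ∂constrainedSpec Φ lam T ω' Δ ω ∂μ ≤ ∫⁻ ω, f ω ∂μ + ε ∧
      ∫⁻ ω, f ω ∂μ ≤ ∫⁻ ω, ∫⁻ ξ, f ξ ∂constrainedSpec Φ lam T ω' Δ ω ∂μ + ε := by
    have hε3 : 0 < ε / 3 := ENNReal.div_pos hε.ne' (by simp)
    obtain ⟨l, hlΔ, hlsum, hlε⟩ := exists_dustList_sum_lt (tsum_dobrushinMatrix_le Φ lam T) hDob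
      (tsum_indicator_finset_ne_top D) Δ hε3
    set b := dustList (dobrushinMatrix Φ lam T) l fun j => if j ∈ D then 1 else 0
    have hb : ∑' j, b j ≠ ∞ := ne_top_of_le_ne_top (tsum_indicator_finset_ne_top D) hlsum
    set g := averageList Φ lam T ω' l f
    have hgm : Measurable g := measurable_averageList hT hΦ hpos ω' l hfm
    have hg1 : ∀ ω, g ω ≤ 1 := averageList_le_one hT hΦ hpos ω' l hf1
    have hgb : HammingBound T ω' g b := hfH.averageList hT hΦ hpos hfm hf1 l
    have hin {ω ω₂ : G → S} (hω : ∀ i, T (ω i) = ω' i) (hω₂ : ∀ i, T (ω₂ i) = ω' i)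
        (h : ∀ j ∉ Δ, ω j = ω₂ j) : g ω ≤ g ω₂ + ε / 3 := by
      refine (hgb ω ω₂ hω hω₂).trans (add_le_add le_rfl (le_trans ?_ hlε.le))
      refine ENNReal.tsum_le_tsum fun j => ?_
      by_cases hj : j ∈ Δ
      · simp only [hj, if_true]
        split_ifs <;> simp
      · simp [h j hj]
    have hupd {ω : G → S} (hω : ∀ i, T (ω i) = ω' i) {y : Δ → S} (hy : ∀ i, T (y i) = ω' i)
        (i : G) : T (Function.updateFinset ω Δ y i) = ω' i := by
      by_cases hi : i ∈ Δ
      · simpa [Function.updateFinset, hi] using hy ⟨i, hi⟩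
      · simpa [Function.updateFinset, hi] using hω i
    have hupe (ω : G → S) (y : Δ → S) (j : G) (hj : j ∉ Δ) :
        Function.updateFinset ω Δ y j = ω j := by simp [Function.updateFinset, hj]
    have hpt {ω : G → S} (hω : ∀ i, T (ω i) = ω' i) :
        ∫⁻ ξ, f ξ ∂constrainedSpec Φ lam T ω' Δ ω ≤ g ω + ε / 3 ∧
        g ω ≤ ∫⁻ ξ, f ξ ∂constrainedSpec Φ lam T ω' Δ ω + ε / 3 := by
      have hp := isProbabilityMeasure_constrainedSpec hT hΦ hpos ω' Δ ω
      rw [← lintegral_averageList_constrainedSpec hT hΦ hpos ω' hlΔ hfm ω]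
      constructor
      · calc _ ≤ ∫⁻ ξ, (g ω + ε / 3) ∂constrainedSpec Φ lam T ω' Δ ω :=
              lintegral_constrainedSpec_mono hT hΦ hpos ω' Δ ω hgm measurable_const
                fun y hy => hin (hupd hω hy) hω (hupe ω y)
          _ = _ := by simp
      · calc g ω = ∫⁻ ξ, g ω ∂constrainedSpec Φ lam T ω' Δ ω := by simp
          _ ≤ ∫⁻ ξ, (g ξ + ε / 3) ∂constrainedSpec Φ lam T ω' Δ ω :=
              lintegral_constrainedSpec_mono hT hΦ hpos ω' Δ ω measurable_const
                (hgm.add measurable_const)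
                fun y hy => hin hω (hupd hω hy) fun j hj => (hupe ω y j hj).symm
          _ = _ := by rw [lintegral_add_right _ measurable_const]; simp [g]
    have hint : ∫⁻ ω, ∫⁻ ξ, f ξ ∂constrainedSpec Φ lam T ω' Δ ω ∂μ ≤ ∫⁻ ω, g ω ∂μ + ε / 3 ∧
        ∫⁻ ω, g ω ∂μ ≤ ∫⁻ ω, ∫⁻ ξ, f ξ ∂constrainedSpec Φ lam T ω' Δ ω ∂μ + ε / 3 := by
      have hc (u : (G → S) → ℝ≥0∞) : ∫⁻ ω, u ω ∂μ + ε / 3 = ∫⁻ ω, (u ω + ε / 3) ∂μ := by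
        rw [lintegral_add_right _ measurable_const]; simp
      rw [hc, hc]
      exact ⟨lintegral_mono_ae (hμae.mono fun ω hω => (hpt hω).1),
        lintegral_mono_ae (hμae.mono fun ω hω => (hpt hω).2)⟩
    obtain ⟨Λ, hΛg, hΛf, hΛ⟩ := ((hquasi b hb g hgm hg1 hgb (ε / 3) hε3).and
      ((hquasi _ (tsum_indicator_finset_ne_top D) f hfm hf1 hfH (ε / 3) hε3).and
        (Filter.eventually_ge_atTop Δ))).exists
    have heq : ∫⁻ ω, g ω ∂ν Λ = ∫⁻ ω, f ω ∂ν Λ :=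
      lintegral_averageList_constrainedSpec hT hΦ hpos ω' (fun i hi => hΛ (hlΔ i hi)) hfm η
    rw [heq] at hΛg
    have e3 (x : ℝ≥0∞) : x + ε / 3 + ε / 3 + ε / 3 = x + ε := by
      rw [add_assoc, add_assoc, ← add_assoc (ε / 3), ENNReal.add_thirds]
    constructor
    · calc _ ≤ _ := hint.1
        _ ≤ (∫⁻ ω, f ω ∂ν Λ + ε / 3) + ε / 3 := by gcongr; exact hΛg.2
        _ ≤ ((∫⁻ ω, f ω ∂μ + ε / 3) + ε / 3) + ε / 3 := by gcongr; exact hΛf.1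
        _ = _ := e3 _
    · calc _ ≤ _ := hΛf.2
        _ ≤ (∫⁻ ω, g ω ∂μ + ε / 3) + ε / 3 := by gcongr; exact hΛg.1
        _ ≤ ((∫⁻ ω, ∫⁻ ξ, f ξ ∂constrainedSpec Φ lam T ω' Δ ω ∂μ + ε / 3) + ε / 3) + ε / 3 := by
            gcongr; exact hint.2
        _ = _ := e3 _
  exact le_antisymm
    (ENNReal.le_of_forall_pos_le_add fun ε hε _ => (key ε (by exact_mod_cast hε)).1)
    (ENNReal.le_of_forall_pos_le_add fun ε hε _ => (key ε (by exact_mod_cast hε)).2)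

end Existence

/-! ### Uniqueness and measurability in the colours. -/

section Uniqueness

variable {G S : Type*} [Countable G] [MeasurableSpace S] {Φ : Potential G S}
  {lam : Measure S} [IsFiniteMeasure lam] {q : ℕ} {T : S → Fin q} (hT : Measurable T)
  (hΦ : AbsolutelySummable Φ) (hpos : ∀ k : Fin q, 0 < lam (T ⁻¹' {k}))

include hT hΦ hpos in
lemma IsConstrainedGibbs.lintegral {ω' : G → Fin q} {μ : Measure (G → S)}
    (h : IsConstrainedGibbs Φ lam T ω' μ) (Λ : Finset G) {f : (G → S) → ℝ≥0∞} (hf : Measurable f) :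
    ∫⁻ ω, ∫⁻ ξ, f ξ ∂constrainedSpec Φ lam T ω' Λ ω ∂μ = ∫⁻ ω, f ω ∂μ := by
  have hm := measurable_constrainedSpec (Φ := Φ) (lam := lam) hT hΦ hpos ω' Λ
  rw [← Measure.lintegral_bind hm.aemeasurable hf.aemeasurable]
  congr 1
  ext B hB
  rw [Measure.bind_apply hB hm.aemeasurable]
  exact h.dlr Λ B hB

variable (hDob : dobrushinConstant Φ lam T < 1)

include hT hΦ hpos hDob in
/-- A constrained Gibbs measure is the infinite-volume limit of the specification. -/
lemma IsConstrainedGibbs.tendsto {ω' : G → Fin q} {μ : Measure (G → S)}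
    (h : IsConstrainedGibbs Φ lam T ω' μ) {η : G → S} (hη : ∀ i, T (η i) = ω' i)
    {B : Set (G → S)} (hB : B ∈ measurableCylinders fun _ : G => S) :
    Filter.Tendsto (fun Λ => constrainedSpec Φ lam T ω' Λ η B) Filter.atTop (nhds (μ B)) := by
  have hμ := h.isProbabilityMeasure
  obtain ⟨D, C, hCm, rfl⟩ := (mem_measurableCylinders _).1 hB
  have hcm : MeasurableSet (cylinder (α := fun _ : G => S) D C) := hCm.cylinder D
  set f : (G → S) → ℝ≥0∞ := (cylinder (α := fun _ => S) D C).indicator 1 with hf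
  have hfm : Measurable f := measurable_one.indicator hcm
  have hf1 : ∀ ω, f ω ≤ 1 := indicator_one_le_one _
  have hfH := hammingBound_of_dependsOn T ω' (dependsOn_indicator_cylinder (S := S) D C) hf1
  rw [ENNReal.tendsto_nhds (measure_ne_top _ _)]
  intro ε hε
  obtain ⟨Λ₀, hΛ₀⟩ := exists_finset_lintegral_le hT hΦ hpos hDob ω'
    (tsum_indicator_finset_ne_top D) hε
  filter_upwards [Filter.eventually_ge_atTop Λ₀] with Λ hΛ
  -- By the DLR equation the `μ`-integral is an average of expectations in `Λ` over boundary
  -- conditions, all of them within `ε` of the one for `η`.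
  rw [← lintegral_indicator_one hcm, ← lintegral_indicator_one hcm,
    ← h.lintegral hT hΦ hpos Λ hfm]
  constructor
  · rw [tsub_le_iff_right]
    calc ∫⁻ ω, ∫⁻ ξ, f ξ ∂constrainedSpec Φ lam T ω' Λ ω ∂μ
        ≤ ∫⁻ ω, (∫⁻ ξ, f ξ ∂constrainedSpec Φ lam T ω' Λ η + ε) ∂μ :=
          lintegral_mono_ae (h.ae_mem.mono fun ω hω =>
            hΛ₀ Λ Λ hΛ hΛ f hfm hf1 hfH ω η hω hη)
      _ = _ := by simp [f]
  · calc ∫⁻ ξ, f ξ ∂constrainedSpec Φ lam T ω' Λ η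
        = ∫⁻ ω, ∫⁻ ξ, f ξ ∂constrainedSpec Φ lam T ω' Λ η ∂μ := by simp
      _ ≤ ∫⁻ ω, (∫⁻ ξ, f ξ ∂constrainedSpec Φ lam T ω' Λ ω + ε) ∂μ :=
          lintegral_mono_ae (h.ae_mem.mono fun ω hω =>
            hΛ₀ Λ Λ hΛ hΛ f hfm hf1 hfH η ω hη hω)
      _ = _ := by rw [lintegral_add_right _ measurable_const]; simp

include hT hΦ hpos hDob in
lemma IsConstrainedGibbs.unique {ω' : G → Fin q} {μ ν : Measure (G → S)}
    (hμ : IsConstrainedGibbs Φ lam T ω' μ) (hν : IsConstrainedGibbs Φ lam T ω' ν) : μ = ν := by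
  have h1 := hμ.isProbabilityMeasure
  have h2 := hν.isProbabilityMeasure
  obtain ⟨s, hs⟩ := exists_section (T := T) hpos
  have hη (i : G) : T (s (ω' i)) = ω' i := hs _
  exact ext_of_generate_finite (measurableCylinders fun _ : G => S)
    generateFrom_measurableCylinders.symm isPiSystem_measurableCylinders
    (fun B hB => tendsto_nhds_unique (hμ.tendsto hT hΦ hpos hDob hη hB)
      (hν.tendsto hT hΦ hpos hDob hη hB)) (by simp)

-- The colour constraint is moved from the reference measure back into the integrand, where the
-- dependence on `ω'` and the spins is jointly measurable.
include hT hΦ hpos in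
lemma measurable_constrainedSpec_color {s : Fin q → S} (Λ : Finset G)
    {B : Set (G → S)} (hB : MeasurableSet B) :
    Measurable fun ω' : G → Fin q => constrainedSpec Φ lam T ω' Λ (fun i => s (ω' i)) B := by
  classical
  have hs : Measurable s := measurable_of_finite s
  have key (f : (G → S) → ℝ≥0∞) (hf : Measurable f) : Measurable fun ω' : G → Fin q =>
      lmarginal (colorMeasure lam T ω') Λ f fun i => s (ω' i) := by
    simp_rw [← lmarginal_indicator_color hT]
    simp only [lmarginal]
    have hu : Measurable fun p : (G → Fin q) × (Λ → S) =>
        Function.updateFinset (fun i => s (p.1 i)) Λ p.2 :=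
      measurable_updateFinset'.comp ((measurable_pi_iff.2 fun i =>
        hs.comp ((measurable_pi_apply i).comp measurable_fst)).prodMk measurable_snd)
    have hE : MeasurableSet {p : (G → Fin q) × (Λ → S) |
        ∀ i ∈ Λ, T (Function.updateFinset (fun i => s (p.1 i)) Λ p.2 i) = p.1 i} := by
      have : {p : (G → Fin q) × (Λ → S) |
          ∀ i ∈ Λ, T (Function.updateFinset (fun i => s (p.1 i)) Λ p.2 i) = p.1 i} =
          ⋂ i ∈ Λ, {p | T (Function.updateFinset (fun i => s (p.1 i)) Λ p.2 i) = p.1 i} := by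
        ext; simp
      rw [this]
      exact Finset.measurableSet_biInter _ fun i _ => measurableSet_eq_fun
        (hT.comp ((measurable_pi_apply i).comp hu)) ((measurable_pi_apply i).comp measurable_fst)
    exact Measurable.lintegral_prod_right ((hf.comp hu).indicator hE)
  simp_rw [← lintegral_indicator_one hB,
    lintegral_constrainedSpec hT hΦ hpos _ Λ _ (measurable_one.indicator hB)]
  exact (key _ (measurable_boltzmann hΦ Λ)).inv.mul
    (key _ ((measurable_boltzmann hΦ Λ).mul (measurable_one.indicator hB)))

include hT hΦ hpos hDob in
/-- The constrained Gibbs measures form a probability kernel. -/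
lemma exists_gibbsKernel : ∃ muG : Kernel (G → Fin q) (G → S),
    ∀ ω', IsConstrainedGibbs Φ lam T ω' (muG ω') := by
  choose m hm using exists_isConstrainedGibbs (Φ := Φ) (lam := lam) hT hΦ hpos hDob
  have hmp (ω' : G → Fin q) : IsProbabilityMeasure (m ω') := (hm ω').isProbabilityMeasure
  obtain ⟨s, hs⟩ := exists_section (T := T) hpos
  refine ⟨⟨m, ?_⟩, hm⟩
  refine Measurable.measure_of_isPiSystem_of_isProbabilityMeasure
    (S := measurableCylinders fun _ : G => S) generateFrom_measurableCylinders.symm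
    isPiSystem_measurableCylinders fun B hB => ?_
  refine measurable_of_tendsto_metrizable' Filter.atTop
    (fun Λ => measurable_constrainedSpec_color (s := s) hT hΦ hpos Λ
      (MeasurableSet.of_mem_measurableCylinders hB)) (tendsto_pi_nhds.2 fun ω' => ?_)
  exact (hm ω').tendsto hT hΦ hpos hDob (fun i => hs _) hB

end Uniqueness

/-! ### Tail events and finite recolouring. -/

section FiniteChange

variable {G S : Type*} [Countable G] [MeasurableSpace S] {Φ : Potential G S}
  {lam : Measure S} [IsFiniteMeasure lam] {q : ℕ} {T : S → Fin q} (hT : Measurable T)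
  (hΦ : AbsolutelySummable Φ) (hpos : ∀ k : Fin q, 0 < lam (T ⁻¹' {k}))

omit [Countable G] in
lemma measurableSet_of_tail {E : Type*} [MeasurableSpace E] {A : Set (G → E)}
    (hA : MeasurableSet[tailSigmaAlgebra G E] A) : MeasurableSet A := by
  have h := MeasurableSpace.measurableSet_iInf.1 hA ∅
  exact cylinderEvents_le_pi _ h

omit [Countable G] in
lemma mem_iff_of_tail {E : Type*} [MeasurableSpace E] {A : Set (G → E)}
    (hA : MeasurableSet[tailSigmaAlgebra G E] A) (Λ : Finset G) {ω ω₂ : G → E}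
    (h : ∀ i ∉ Λ, ω i = ω₂ i) : ω ∈ A ↔ ω₂ ∈ A :=
  mem_iff_of_measurableSet_cylinderEvents (MeasurableSpace.measurableSet_iInf.1 hA Λ)
    fun i hi => h i (by simpa using hi)

-- A tail indicator does not depend on the spins in `Λ` and comes out of the integral.
include hT hΦ hpos in
lemma lintegral_constrainedSpec_indicator_tail (ω' : G → Fin q) (Λ : Finset G) (η : G → S)
    {A : Set (G → S)} (hA : MeasurableSet[tailSigmaAlgebra G S] A) {f : (G → S) → ℝ≥0∞}
    (hf : Measurable f) :
    ∫⁻ ξ, A.indicator f ξ ∂constrainedSpec Φ lam T ω' Λ η =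
      A.indicator (fun η => ∫⁻ ξ, f ξ ∂constrainedSpec Φ lam T ω' Λ η) η := by
  classical
  have hAm := measurableSet_of_tail hA
  rw [lintegral_constrainedSpec hT hΦ hpos ω' Λ η (hf.indicator hAm)]
  have h1 : (fun ω => boltzmann Φ Λ ω * A.indicator f ω) =
      fun ω => A.indicator 1 ω * (boltzmann Φ Λ ω * f ω) := by
    ext ω
    by_cases hω : ω ∈ A <;> simp [hω]
  have hwf : Measurable fun ω => boltzmann Φ Λ ω * f ω := (measurable_boltzmann hΦ Λ).mul hf
  rw [h1, lmarginal_mul_of_dependsOn_compl _ hwf fun ω ω₂ h => by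
    by_cases hω : ω ∈ A
    · rw [Set.indicator_of_mem hω, Set.indicator_of_mem ((mem_iff_of_tail hA Λ h).1 hω)]; simp
    · rw [Set.indicator_of_notMem hω,
        Set.indicator_of_notMem (mt (mem_iff_of_tail hA Λ h).2 hω)]]
  by_cases hη : η ∈ A
  · simp only [hη, Set.indicator_of_mem, Pi.one_apply, one_mul]
    exact (lintegral_constrainedSpec hT hΦ hpos ω' Λ η hf).symm
  · simp [hη]

-- Hence the restriction of a Gibbs measure to a tail event still satisfies the DLR equations.
include hT hΦ hpos in
lemma IsConstrainedGibbs.setLIntegral_tail {ω' : G → Fin q} {μ : Measure (G → S)}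
    (h : IsConstrainedGibbs Φ lam T ω' μ) {A : Set (G → S)}
    (hA : MeasurableSet[tailSigmaAlgebra G S] A) (Λ : Finset G) {f : (G → S) → ℝ≥0∞}
    (hf : Measurable f) :
    ∫⁻ ω in A, ∫⁻ ξ, f ξ ∂constrainedSpec Φ lam T ω' Λ ω ∂μ = ∫⁻ ω in A, f ω ∂μ := by
  have hAm := measurableSet_of_tail hA
  rw [← lintegral_indicator hAm, ← lintegral_indicator hAm,
    ← h.lintegral hT hΦ hpos Λ (hf.indicator hAm)]
  exact lintegral_congr fun η =>
    (lintegral_constrainedSpec_indicator_tail hT hΦ hpos ω' Λ η hA hf).symm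

include hT hΦ hpos in
open scoped Classical in
/-- Recolouring inside `Λ`: the weights relative to the old colours can be computed in any larger
volume. -/
lemma IsConstrainedGibbs.setLIntegral_recolor {ω' ω₂' : G → Fin q} {Λ Δ : Finset G}
    (hω : ∀ i ∉ Λ, ω' i = ω₂' i) (hΛ : Λ ⊆ Δ) {μ : Measure (G → S)}
    (h : IsConstrainedGibbs Φ lam T ω' μ) {A : Set (G → S)}
    (hA : MeasurableSet[tailSigmaAlgebra G S] A) {g : (G → S) → ℝ≥0∞} (hg : Measurable g) :
    ∫⁻ η in A, (partitionFunction Φ lam T ω' Λ η)⁻¹ *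
        lmarginal (colorMeasure lam T ω₂') Λ (fun ω => boltzmann Φ Λ ω * g ω) η ∂μ =
      ∫⁻ η in A, (partitionFunction Φ lam T ω' Δ η)⁻¹ *
        lmarginal (colorMeasure lam T ω₂') Δ (fun ω => boltzmann Φ Δ ω * g ω) η ∂μ := by
  have hwΛ := measurable_boltzmann hΦ Λ
  have hwΔ := measurable_boltzmann hΦ Δ
  set u : (G → S) → ℝ≥0∞ := fun η => (partitionFunction Φ lam T ω' Λ η)⁻¹ *
    lmarginal (colorMeasure lam T ω₂') Λ (fun ω => boltzmann Φ Λ ω * g ω) η with hu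
  have hum : Measurable u :=
    (measurable_partitionFunction hΦ ω' Λ).inv.mul ((hwΛ.mul hg).lmarginal _)
  -- As `u` ignores the spins in `Λ`, the old-colour integral over `Λ` only yields the partition
  -- function in its denominator (`hin`). What remains lives on `Δ \ Λ`, where the two colourings
  -- agree.
  have huc (ω ω₂ : G → S) (hωω : ∀ i ∉ Λ, ω i = ω₂ i) : u ω = u ω₂ := by
    simp only [hu]
    rw [partitionFunction_congr ω' Λ hωω, lmarginal_congr _ _ hωω]
  rw [← h.setLIntegral_tail hT hΦ hpos hA Δ hum]
  refine lintegral_congr fun η => ?_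
  rw [lintegral_constrainedSpec hT hΦ hpos ω' Δ η hum]
  congr 1
  rw [← Finset.sdiff_union_of_subset hΛ, lmarginal_union _ _ (by
      rw [Finset.sdiff_union_of_subset hΛ]; exact hwΔ.mul hum) Finset.sdiff_disjoint,
    lmarginal_union _ _ (by
      rw [Finset.sdiff_union_of_subset hΛ]; exact hwΔ.mul hg) Finset.sdiff_disjoint,
    Finset.sdiff_union_of_subset hΛ]
  have hin : lmarginal (colorMeasure lam T ω') Λ (fun ω => boltzmann Φ Δ ω * u ω) =
      lmarginal (colorMeasure lam T ω₂') Λ (fun ω => boltzmann Φ Δ ω * g ω) := by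
    ext ζ
    rw [lmarginal_boltzmann_of_subset hΦ _ hΛ hum, lmarginal_boltzmann_of_subset hΦ _ hΛ hg]
    congr 1
    simp_rw [mul_comm (boltzmann Φ Λ _) (u _)]
    rw [lmarginal_mul_of_dependsOn_compl _ hwΛ huc, hu, mul_comm, ← mul_assoc]
    change partitionFunction Φ lam T ω' Λ ζ * _ * _ = _
    rw [ENNReal.mul_inv_cancel (partitionFunction_ne_zero hΦ hpos ω' Λ ζ)
      (partitionFunction_ne_top hΦ ω' Λ ζ), one_mul]
  rw [hin]
  simp only [lmarginal]
  have hcol : (fun i : (Δ \ Λ : Finset G) => colorMeasure lam T ω' i) =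
      fun i : (Δ \ Λ : Finset G) => colorMeasure lam T ω₂' i := by
    ext1 i
    simp only [colorMeasure]
    rw [hω i (Finset.mem_sdiff.1 i.2).2]
  rw [hcol]

include hT hΦ hpos in
/-- If a tail event has positive probability under a Gibbs measure for the colours `ω'`, then it
has full probability under some Gibbs measure for any finite modification of `ω'`. -/
lemma IsConstrainedGibbs.exists_recolor {ω' ω₂' : G → Fin q} {Λ : Finset G}
    (hω : ∀ i ∉ Λ, ω' i = ω₂' i) {μ : Measure (G → S)}
    (h : IsConstrainedGibbs Φ lam T ω' μ) {A : Set (G → S)}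
    (hA : MeasurableSet[tailSigmaAlgebra G S] A) (hμA : μ A ≠ 0) :
    ∃ ν : Measure (G → S), IsConstrainedGibbs Φ lam T ω₂' ν ∧ ν A = 1 := by
  classical
  have hμ := h.isProbabilityMeasure
  have hAm := measurableSet_of_tail hA
  have hspm := measurable_constrainedSpec (Φ := Φ) (lam := lam) hT hΦ hpos ω₂' Λ
  have hspp (η : G → S) : IsProbabilityMeasure (constrainedSpec Φ lam T ω₂' Λ η) :=
    isProbabilityMeasure_constrainedSpec hT hΦ hpos ω₂' Λ η
  have hZm := measurable_partitionFunction (lam := lam) (T := T) hΦ ω' Λ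
  have hZ₂m := measurable_partitionFunction (lam := lam) (T := T) hΦ ω₂' Λ
  -- This density trades the new normalisation for the old one (`hMf`), the form that
  -- `setLIntegral_recolor` transfers to larger volumes.
  set d : (G → S) → ℝ≥0∞ := fun η =>
    (partitionFunction Φ lam T ω' Λ η)⁻¹ * partitionFunction Φ lam T ω₂' Λ η with hd
  have hdm : Measurable d := hZm.inv.mul hZ₂m
  set M : Measure (G → S) :=
    ((μ.restrict A).withDensity d).bind (constrainedSpec Φ lam T ω₂' Λ) with hM
  have hMd (f : (G → S) → ℝ≥0∞) (hf : Measurable f) : ∫⁻ ω, f ω ∂M =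
      ∫⁻ η in A, d η * ∫⁻ ξ, f ξ ∂constrainedSpec Φ lam T ω₂' Λ η ∂μ := by
    rw [hM, Measure.lintegral_bind hspm.aemeasurable hf.aemeasurable]
    exact lintegral_withDensity_eq_lintegral_mul _ hdm
      (measurable_lintegral_constrainedSpec hT hΦ hpos ω₂' Λ hf)
  have hMf (f : (G → S) → ℝ≥0∞) (hf : Measurable f) : ∫⁻ ω, f ω ∂M =
      ∫⁻ η in A, (partitionFunction Φ lam T ω' Λ η)⁻¹ *
        lmarginal (colorMeasure lam T ω₂') Λ (fun ω => boltzmann Φ Λ ω * f ω) η ∂μ := by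
    rw [hMd f hf]
    refine lintegral_congr fun η => ?_
    rw [lintegral_constrainedSpec hT hΦ hpos ω₂' Λ η hf, hd, mul_assoc, ← mul_assoc _ _⁻¹ _,
      ENNReal.mul_inv_cancel (partitionFunction_ne_zero hΦ hpos ω₂' Λ η)
      (partitionFunction_ne_top hΦ ω₂' Λ η), one_mul]
  have hMu : M Set.univ = ∫⁻ η in A, d η ∂μ := by
    rw [← lintegral_one, hMd _ measurable_const]
    simp
  have hd0 (η : G → S) : d η ≠ 0 := mul_ne_zero
    (ENNReal.inv_ne_zero.2 (partitionFunction_ne_top hΦ ω' Λ η))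
    (partitionFunction_ne_zero hΦ hpos ω₂' Λ η)
  have hM0 : M Set.univ ≠ 0 := by
    rw [hMu]
    intro h0
    rw [setLIntegral_eq_zero_iff hAm hdm] at h0
    exact hμA (measure_mono_null (fun η hη => fun h => hd0 η (h hη)) h0)
  have hMtop : M Set.univ ≠ ∞ := by
    rw [hMu]
    set m : ℝ≥0∞ := ENNReal.ofReal (Real.exp (-energyBound Φ Λ)) *
      ∏ i : Λ, lam (T ⁻¹' {ω' i})
    have hm0 : m ≠ 0 := mul_ne_zero (by simp [Real.exp_pos])
      (Finset.prod_ne_zero_iff.2 fun j _ => (hpos _).ne')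
    set m₂ : ℝ≥0∞ := ENNReal.ofReal (Real.exp (energyBound Φ Λ)) *
      ∏ i : Λ, lam (T ⁻¹' {ω₂' i})
    have hm₂ : m₂ ≠ ∞ := ENNReal.mul_ne_top ENNReal.ofReal_ne_top
      (ENNReal.prod_ne_top fun _ _ => measure_ne_top _ _)
    refine ne_top_of_le_ne_top ?_ (lintegral_mono (g := fun _ => m⁻¹ * m₂) fun η =>
      mul_le_mul' (ENNReal.inv_le_inv.2 (le_partitionFunction hΦ ω' Λ η))
        (partitionFunction_le hΦ ω₂' Λ η))
    rw [lintegral_const]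
    exact ENNReal.mul_ne_top (ENNReal.mul_ne_top (ENNReal.inv_ne_top.2 hm0) hm₂)
      (measure_ne_top _ _)
  have hMae : ∀ᵐ ω ∂M, ∀ i, T (ω i) = ω₂' i := by
    have hN : MeasurableSet {ω : G → S | ∀ i, T (ω i) = ω₂' i}ᶜ := by
      rw [Set.ofPred_forall]
      exact (MeasurableSet.iInter fun i => measurableSet_color hT ω₂' i).compl
    rw [ae_iff]
    change M {ω : G → S | ∀ i, T (ω i) = ω₂' i}ᶜ = 0
    rw [← lintegral_indicator_one hN, hMd _ (measurable_one.indicator hN)]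
    refine Eq.trans (lintegral_congr_ae (g := fun _ => 0) ?_) lintegral_zero
    filter_upwards [ae_restrict_of_ae h.ae_mem] with η hη
    rw [lintegral_indicator_one hN]
    have : constrainedSpec Φ lam T ω₂' Λ η {ω : G → S | ∀ i, T (ω i) = ω₂' i}ᶜ = 0 :=
      ae_constrainedSpec_of_compl hT hΦ hpos fun i hi => (hη i).trans (hω i hi)
    simp [this]
  have hMA : M A = M Set.univ := by
    rw [hMu, ← lintegral_indicator_one hAm, hMd _ (measurable_one.indicator hAm)]
    refine setLIntegral_congr_fun hAm fun η hη => ?_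
    have := lintegral_constrainedSpec_indicator_tail (Φ := Φ) (lam := lam) hT hΦ hpos ω₂' Λ η hA
      (measurable_const (a := (1 : ℝ≥0∞)))
    simp only [hη, Set.indicator_of_mem, lintegral_one, measure_univ] at this
    change d η * ∫⁻ ξ, A.indicator (fun _ => 1) ξ ∂_ = d η
    rw [this, mul_one]
  -- Both sides are rewritten in the volume `Λ ∪ Δ`, where consistency for the new colours applies
  -- because it contains `Δ`.
  have hMdlr (Δ : Finset G) (f : (G → S) → ℝ≥0∞) (hf : Measurable f) :
      ∫⁻ ω, ∫⁻ ξ, f ξ ∂constrainedSpec Φ lam T ω₂' Δ ω ∂M = ∫⁻ ω, f ω ∂M := by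
    have hg := measurable_lintegral_constrainedSpec (Φ := Φ) (lam := lam) hT hΦ hpos ω₂' Δ hf
    rw [hMf _ hg, hMf f hf,
      h.setLIntegral_recolor hT hΦ hpos hω (Finset.subset_union_left (s₂ := Δ)) hA hg,
      h.setLIntegral_recolor hT hΦ hpos hω (Finset.subset_union_left (s₂ := Δ)) hA hf,
      lmarginal_boltzmann_mul_lintegral hT hΦ hpos ω₂' Finset.subset_union_right hf]
  refine ⟨(M Set.univ)⁻¹ • M, ⟨⟨?_⟩, ?_, fun Δ B hB => ?_⟩, ?_⟩
  · simp [ENNReal.inv_mul_cancel hM0 hMtop]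
  · exact Measure.ae_smul_measure hMae _
  · rw [lintegral_smul_measure, Measure.smul_apply]
    congr 1
    have := hMdlr Δ (B.indicator 1) (measurable_one.indicator hB)
    simpa only [lintegral_indicator_one hB] using this
  · rw [Measure.smul_apply, hMA, smul_eq_mul, ENNReal.inv_mul_cancel hM0 hMtop]

end FiniteChange

end ConstrainedGibbs

theorem mainTheorem9 {G S : Type*} [Countable G] [MeasurableSpace S]
    (Φ : ConstrainedGibbs.Potential G S) (hΦ : ConstrainedGibbs.AbsolutelySummable Φ)
    (lam : Measure S) [IsFiniteMeasure lam]
    {q : ℕ} (T : S → Fin q) (hT : Measurable T) (hpos : ∀ k : Fin q, 0 < lam (T ⁻¹' {k}))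
    (hDob : ConstrainedGibbs.dobrushinConstant Φ lam T < 1) :
    ∃ muG : Kernel (G → Fin q) (G → S),
      (∀ (ω' : G → Fin q) (ν : Measure (G → S)),
        ConstrainedGibbs.IsConstrainedGibbs Φ lam T ω' ν ↔ ν = muG ω') ∧
      ∀ (μ' : Measure (G → Fin q)), IsProbabilityMeasure μ' →
        ConstrainedGibbs.TailTrivial μ' →
          ConstrainedGibbs.TailTrivial (Measure.bind μ' muG) := by
  classical
  obtain ⟨muG, hmu⟩ := ConstrainedGibbs.exists_gibbsKernel (Φ := Φ) (lam := lam) hT hΦ hpos hDob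
  refine ⟨muG, fun ω' ν => ⟨fun hν => hν.unique hT hΦ hpos hDob (hmu ω'), fun hν => hν ▸ hmu ω'⟩,
    fun μ' hμ' htriv A hA => ?_⟩
  have hAm := ConstrainedGibbs.measurableSet_of_tail hA
  have hone (Λ : Finset G) {ω' ω₂' : G → Fin q} (hω : ∀ i ∉ Λ, ω' i = ω₂' i)
      (h0 : muG ω' A ≠ 0) : muG ω₂' A = 1 := by
    obtain ⟨ν, hν, hνA⟩ := (hmu ω').exists_recolor hT hΦ hpos hω hA h0
    rw [(hmu ω₂').unique hT hΦ hpos hDob hν, hνA]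
  set V : Set (G → Fin q) := {ω' | muG ω' A = 1} with hV
  have hVm : MeasurableSet V := muG.measurable_coe hAm (measurableSet_singleton 1)
  have hVind (ω' : G → Fin q) : muG ω' A = V.indicator 1 ω' := by
    by_cases h : muG ω' A = 0
    · have : ω' ∉ V := fun hm => by simp [hV, h] at hm
      rw [h, Set.indicator_of_notMem this]
    · have h1 := hone ∅ (fun i _ => rfl) h
      have : ω' ∈ V := h1
      rw [h1, Set.indicator_of_mem this, Pi.one_apply]
  obtain ⟨ω₀⟩ : Nonempty (G → Fin q) := nonempty_of_isProbabilityMeasure μ'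
  have hVtail : MeasurableSet[ConstrainedGibbs.tailSigmaAlgebra G (Fin q)] V := by
    refine MeasurableSpace.measurableSet_iInf.2 fun Λ => ?_
    -- Overwriting the colours in `Λ` by fixed ones is measurable with respect to the outside of `Λ`
    -- and, by `hone`, preserves membership in `V`.
    set fill : (G → Fin q) → G → Fin q := fun ω' i => if i ∈ Λ then ω₀ i else ω' i
    have hfill : Measurable[cylinderEvents ((Λ : Set G)ᶜ)] fill := by
      refine @measurable_pi_lambda _ _ _ (cylinderEvents ((Λ : Set G)ᶜ)) _ _ fun i => ?_
      by_cases hi : i ∈ Λ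
      · simp only [fill, hi, if_true]
        exact measurable_const
      · simp only [fill, hi, if_false]
        exact measurable_cylinderEvent_apply (by simpa using hi)
    have : V = fill ⁻¹' V := by
      ext ω'
      have hoff : ∀ i ∉ Λ, ω' i = fill ω' i := fun i hi => by simp [fill, hi]
      constructor
      · intro h
        exact hone Λ hoff (by rw [show muG ω' A = 1 from h]; exact one_ne_zero)
      · intro h
        exact hone Λ (fun i hi => (hoff i hi).symm)
          (by rw [show muG (fill ω') A = 1 from h]; exact one_ne_zero)
    rw [this]
    exact hfill hVm
  have hbind : Measure.bind μ' muG A = μ' V := by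
    rw [Measure.bind_apply hAm muG.measurable.aemeasurable, ← lintegral_indicator_one hVm]
    exact lintegral_congr hVind
  rw [hbind]
  exact htriv V hVtail
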